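/- Let $\mathcal H$ be a separable real Hilbert space with its Borel $\sigma$-algebra. A Borel probability measure $\nu$ on $\mathcal H$ is called Gaussian if its image under every continuous linear functional is a Gaussian measure on $\mathbb R$, point masses included. Its mean is $m=\int x\,\nu(dx)$ and its covariance operator $C$ is the bounded operator with $\langle y_1,Cy_2\rangle=\int\langle x-m,y_1\rangle\langle x-m,y_2\rangle\,\nu(dx)$ for all $y_1,y_2\in\mathcal H$. Two measures are called equivalent if each is absolutely continuous with respect to the other. For probability measures, $D_{\rm KL}(\nu\|\mu)=\int\log\big(\frac{d\nu}{d\mu}\big)\,d\nu$ if $\nu\ll\mu$, and $D_{\rm KL}(\nu\|\mu)=+\infty$ otherwise. Let $\mu_0$ be a Gaussian measure on $\mathcal H$ whose covariance operator $C_0$ is strictly positive, i.e. $\langle x,C_0x\rangle>0$ for all $x\neq0$. Let $X\subseteq\mathcal H$ be a Borel set with $\mu_0(X)=1$ which is a separable Banach space continuously embedded in $\mathcal H$. Let $\Phi:X\to\mathbb R$ be Borel measurable (for instance continuous) with $\exp(-\Phi)$ integrable with respect to $\mu_0$, and let $\mu$ be the probability measure given by $$\frac{d\mu}{d\mu_0}(x)=\frac1Z\exp(-\Phi(x)),\qquad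 Z=\int\exp(-\Phi(x))\,\mu_0(dx).$$ Let $\mathcal A$ be any one of the following four classes: 1. $\mathcal A_1$, all Gaussian measures on $\mathcal H$; 2. $\mathcal A_2$, all Gaussian measures on $\mathcal H$ that are equivalent to $\mu_0$; 3. $\mathcal A_3$, all Gaussian measures on $\mathcal H$ with covariance operator $\hat C$, for a fixed bounded operator $\hat C$ (the class is empty unless $\hat C$ is nonnegative, symmetric and trace class); 4. $\mathcal A_4$, all Gaussian measures on $\mathcal H$ with mean $\hat m$, for a fixed $\hat m\in\mathcal H$. Suppose that there is at least one $\nu\in\mathcal A$ with $D_{\rm KL}(\nu\|\mu)<\infty$. Then $\nu\mapsto D_{\rm KL}(\nu\|\mu)$ attains its minimum over $\mathcal A$ at some element of $\mathcal A$, and every minimiser is equivalent to $\mu_0$. More generally, every $\nu\in\mathcal A$ with $D_{\rm KL}(\nu\|\mu)<\infty$ is equivalent to $\mu_0$. -/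

import Mathlib

open MeasureTheory ProbabilityTheory InformationTheory
open scoped ENNReal RealInnerProductSpace

namespace GaussianKL

/-- Two measures are equivalent if they are mutually absolutely continuous. -/
def MeasureEquivalent {H : Type*} [MeasurableSpace H] (ν μ : Measure H) : Prop :=
  ν ≪ μ ∧ μ ≪ ν

section Classes

variable {H : Type*} [NormedAddCommGroup H] [InnerProductSpace ℝ H]
  [MeasurableSpace H] [BorelSpace H]

/-- `C` is the (centred) covariance operator of `ν`:
`⟪x, C y⟫ = ∫ ⟪x, z - m⟫ ⟪y, z - m⟫ ν(dz)` with `m = ∫ z ν(dz)` the mean of `ν`. -/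
def HasCovariance (ν : Measure H) (C : H →L[ℝ] H) : Prop :=
  ∀ x y : H, covarianceBilin ν x y = ⟪x, C y⟫

variable (H) in
/-- All Gaussian measures on `H` (Dirac measures included). -/
def gaussians : Set (Measure H) :=
  {ν | IsGaussian ν}

/-- The Gaussian measures on `H` that are equivalent to `μ₀`. -/
def gaussiansEquivalentTo (μ₀ : Measure H) : Set (Measure H) :=
  {ν | IsGaussian ν ∧ MeasureEquivalent ν μ₀}

/-- The Gaussian measures on `H` with covariance operator `C`
(the class is empty unless `C` is nonnegative, symmetric and trace class). -/
def gaussiansWithCovariance (C : H →L[ℝ] H) : Set (Measure H) :=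
  {ν | IsGaussian ν ∧ HasCovariance ν C}

/-- The Gaussian measures on `H` with mean `m`. -/
def gaussiansWithMean (m : H) : Set (Measure H) :=
  {ν | IsGaussian ν ∧ ∫ z, z ∂ν = m}

end Classes

section Target

variable {X H : Type*}

/-- The unnormalised density `exp (-Φ)`, for `Φ` defined on `X`, seen as a function on `H` through
the embedding `ι : X → H`. Off the range of `ι`, which will be a `μ₀`-null set, it is `0`. -/
noncomputable def unnormalisedDensity (ι : X → H) (Φ : X → ℝ) : H → ℝ :=
  Function.extend ι (fun u => Real.exp (-Φ u)) (fun _ => 0)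

variable [MeasurableSpace H]

/-- The normalisation constant `Z = ∫ exp (-Φ) dμ₀`. -/
noncomputable def normalisation (μ₀ : Measure H) (ι : X → H) (Φ : X → ℝ) : ℝ :=
  ∫ x, unnormalisedDensity ι Φ x ∂μ₀

/-- The measure `μ` with `dμ/dμ₀ = exp (-Φ) / Z`. -/
noncomputable def target (μ₀ : Measure H) (ι : X → H) (Φ : X → ℝ) : Measure H :=
  μ₀.withDensity fun x =>
    ENNReal.ofReal (unnormalisedDensity ι Φ x / normalisation μ₀ ι Φ)

end Target

end GaussianKL

/-! Existence is the direct method. For probability measures, the divergence of `P` from `Q` is the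
supremum of `∫ f ∂P - ∫ exp f ∂Q + 1` over bounded measurable `f`, and bounded continuous `f`
suffice. Each such expression is weakly continuous in `P`, so the divergence is weakly lower
semicontinuous. Testing with multiples of indicators shows that its sublevel sets are tight. A
minimising sequence therefore has a weak limit whose divergence is at most the infimum. The limit is
Gaussian because means and variances in every direction stay bounded and converge along an
ultrafilter. The same convergence preserves a prescribed mean or covariance.

Equivalence is the part of the Feldman–Hájek dichotomy proved in
`absolutelyContinuous_symm_of_isGaussian`: for Gaussian `P ≪ Q` with `Q` nondegenerate, also `Q ≪
P`. Absolute continuity makes the Hellinger affinity of `P` and `Q` positive, and this bounds from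
below the affinity of all their finite-dimensional projections. In coordinates where both
covariances are diagonal the affinity is a product and the divergence a sum over coordinates. The
one-dimensional inequality `one_add_gaussianEntropy_le` turns the lower bound on the product into an
upper bound on the sum that does not depend on the dimension. Passing to the limit along
projections, the dual expressions for `Q` against `P` are bounded, hence `Q ≪ P`. Finite divergence
from the target gives `ν ≪ μ₀`, so this applies with `Q = μ₀`. -/

namespace GaussianKL

/-! ### Dual description of the Kullback-Leibler divergence -/

section Duality

open Filter Topology BoundedContinuousFunction

variable {E : Type*} [MeasurableSpace E] {P Q : Measure E}

lemma integrable_of_abs_le [IsFiniteMeasure P] {f : E → ℝ} (hf : Measurable f) {B : ℝ}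
    (hB : ∀ x, |f x| ≤ B) : Integrable f P :=
  Integrable.of_bound hf.aestronglyMeasurable B (ae_of_all _ hB)

lemma integrable_exp_of_le [IsFiniteMeasure P] {f : E → ℝ} (hf : Measurable f) {B : ℝ}
    (hB : ∀ x, f x ≤ B) : Integrable (fun x => Real.exp (f x)) P :=
  integrable_of_abs_le hf.exp (B := Real.exp B) fun x => by
    rw [Real.abs_exp]; exact Real.exp_le_exp.2 (hB x)

/-- Young's inequality: `z ↦ exp z - 1` is the convex conjugate of `klFun`, with equality at `z =
log y`. -/
lemma mul_sub_exp_add_one_le_klFun {y : ℝ} (hy : 0 ≤ y) (z : ℝ) :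
    y * z - Real.exp z + 1 ≤ klFun y := by
  rw [klFun_apply]
  rcases hy.eq_or_lt with rfl | hy
  · simp [Real.exp_nonneg]
  · have h := Real.add_one_le_exp (z - Real.log y)
    rw [Real.exp_sub, Real.exp_log hy, le_div_iff₀ hy] at h
    linarith

/-- The easy half of the dual description of the Kullback-Leibler divergence. -/
lemma integral_sub_integral_exp_add_one_le_toReal_klDiv [IsProbabilityMeasure P]
    [IsProbabilityMeasure Q] (hfin : klDiv P Q ≠ ∞) {f : E → ℝ} (hf : Measurable f) {B : ℝ}
    (hB : ∀ x, |f x| ≤ B) :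
    ∫ x, f x ∂P - ∫ x, Real.exp (f x) ∂Q + 1 ≤ (klDiv P Q).toReal := by
  obtain ⟨hac, hint⟩ := klDiv_ne_top_iff.1 hfin
  have hexp : Integrable (fun x => Real.exp (f x)) Q :=
    integrable_exp_of_le hf fun x => (le_abs_self _).trans (hB x)
  have hfP : Integrable f P := integrable_of_abs_le hf hB
  have hmul : Integrable (fun x => (P.rnDeriv Q x).toReal * f x) Q :=
    (integrable_rnDeriv_smul_iff hac).2 hfP
  rw [toReal_klDiv_eq_integral_klFun hac, ← integral_rnDeriv_smul hac]
  simp only [smul_eq_mul]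
  have h1 : ∫ x, ((P.rnDeriv Q x).toReal * f x - Real.exp (f x) + 1) ∂Q
      ≤ ∫ x, klFun (P.rnDeriv Q x).toReal ∂Q :=
    integral_mono ((hmul.sub hexp).add (integrable_const 1))
      ((integrable_klFun_rnDeriv_iff hac).2 hint)
      fun x => mul_sub_exp_add_one_le_klFun ENNReal.toReal_nonneg _
  have h2 := integral_add (hmul.sub hexp) (integrable_const (1 : ℝ))
  simp only [Pi.sub_apply, integral_const, probReal_univ, one_smul] at h2
  rw [h2, integral_sub hmul hexp] at h1
  exact h1

lemma exp_sub_exp_le {a b B : ℝ} (ha : a ≤ B) :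
    Real.exp a - Real.exp b ≤ Real.exp B * |a - b| := by
  have h := Real.add_one_le_exp (b - a)
  have h2 : Real.exp a * (b - a + 1) ≤ Real.exp b := by
    calc _ ≤ Real.exp a * Real.exp (b - a) := by gcongr
      _ = Real.exp b := by rw [← Real.exp_add]; congr 1; ring
  calc Real.exp a - Real.exp b ≤ Real.exp a * (a - b) := by linarith
    _ ≤ Real.exp a * |a - b| := by gcongr; exact le_abs_self _
    _ ≤ _ := by gcongr

/-- Bounded continuous functions are dense in `L¹(P + Q)`, and the dual expression is Lipschitz for
this norm among functions bounded by `B`. -/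
lemma dual_bound_of_boundedContinuous {E : Type*} [MetricSpace E] [MeasurableSpace E]
    [BorelSpace E] {P Q : Measure E} [IsProbabilityMeasure P] [IsProbabilityMeasure Q] {K : ℝ}
    (h : ∀ f : E →ᵇ ℝ, ∫ x, f x ∂P - ∫ x, Real.exp (f x) ∂Q + 1 ≤ K)
    {f : E → ℝ} (hf : Measurable f) {B : ℝ} (hB : ∀ x, |f x| ≤ B) :
    ∫ x, f x ∂P - ∫ x, Real.exp (f x) ∂Q + 1 ≤ K := by
  refine le_of_forall_pos_le_add fun δ hδ => ?_
  -- The `P`-integral contributes an error of at most `ε` and the exponential one at most `exp B *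
  -- ε`, which add up to `δ`.
  set ε : ℝ := δ / (1 + Real.exp B) with hε
  have hεpos : 0 < ε := by positivity
  obtain ⟨g, hg, hgi⟩ := (integrable_of_abs_le (P := P + Q) hf
    hB).exists_boundedContinuous_integral_sub_le hεpos
  -- Clamping the approximant to `[-B, B]` brings it no further from `f` and gives `exp` the
  -- Lipschitz constant `exp B`.
  let c : E → ℝ := fun x => max (-B) (min B (g x))
  have hcc : Continuous c := by fun_prop
  have hcB : ∀ x, |c x| ≤ B := fun x => by
    have hB0 : 0 ≤ B := (abs_nonneg _).trans (hB x)
    exact abs_le.2 ⟨le_max_left _ _, max_le (by linarith) (min_le_left _ _)⟩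
  have hfc : ∀ x, |f x - c x| ≤ ‖f x - g x‖ := fun x => by
    have := abs_le.1 (hB x)
    simp only [c, Real.norm_eq_abs]
    grind
  let G : E →ᵇ ℝ := BoundedContinuousFunction.ofNormedAddCommGroup c hcc B hcB
  have hG := h G
  have hd : Integrable (fun x => ‖f x - g x‖) (P + Q) :=
    ((integrable_of_abs_le hf hB).sub hgi).norm
  rw [integral_add_measure hd.left_of_add_measure hd.right_of_add_measure] at hg
  have hfP : Integrable f P := integrable_of_abs_le hf hB
  have hcP : Integrable c P := integrable_of_abs_le hcc.measurable hcB
  have hfQ : Integrable (fun x => Real.exp (f x)) Q :=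
    integrable_exp_of_le hf fun x => (le_abs_self _).trans (hB x)
  have hcQ : Integrable (fun x => Real.exp (c x)) Q :=
    integrable_exp_of_le hcc.measurable fun x => (le_abs_self _).trans (hcB x)
  have h1 : ∫ x, f x ∂P - ∫ x, c x ∂P ≤ ∫ x, ‖f x - g x‖ ∂P := by
    rw [← integral_sub hfP hcP]
    exact integral_mono (hfP.sub hcP) hd.left_of_add_measure
      fun x => (le_abs_self _).trans (hfc x)
  have h2 : ∫ x, Real.exp (c x) ∂Q - ∫ x, Real.exp (f x) ∂Q
      ≤ Real.exp B * ∫ x, ‖f x - g x‖ ∂Q := by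
    rw [← integral_sub hcQ hfQ, ← integral_const_mul]
    refine integral_mono (hcQ.sub hfQ) (hd.right_of_add_measure.const_mul _) fun x => ?_
    refine (exp_sub_exp_le ((le_abs_self _).trans (hcB x))).trans ?_
    rw [abs_sub_comm]
    exact mul_le_mul_of_nonneg_left (hfc x) (Real.exp_nonneg _)
  have hP0 : 0 ≤ ∫ x, ‖f x - g x‖ ∂P := integral_nonneg fun _ => norm_nonneg _
  have hQ0 : 0 ≤ ∫ x, ‖f x - g x‖ ∂Q := integral_nonneg fun _ => norm_nonneg _
  have h3 : Real.exp B * ∫ x, ‖f x - g x‖ ∂Q ≤ Real.exp B * ε := by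
    gcongr; linarith
  have h4 : ε + Real.exp B * ε = δ := by rw [hε]; field_simp
  have hG' : ∫ x, c x ∂P - ∫ x, Real.exp (c x) ∂Q + 1 ≤ K := hG
  linarith

/-- Testing with `t` times the indicator of a `Q`-null set `A` gives `t * P.real A ≤ K` for every `t
≥ 0`, which forces `P A = 0`. -/
lemma absolutelyContinuous_of_dual_bound [IsProbabilityMeasure P] [IsProbabilityMeasure Q] {K : ℝ}
    (h : ∀ (f : E → ℝ) (B : ℝ), Measurable f → (∀ x, |f x| ≤ B) →
      ∫ x, f x ∂P - ∫ x, Real.exp (f x) ∂Q + 1 ≤ K) : P ≪ Q := by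
  refine Measure.AbsolutelyContinuous.mk fun A hA hQA => ?_
  have key : ∀ t : ℝ, 0 ≤ t → t * P.real A ≤ K := fun t ht => by
    have h1 := h (A.indicator fun _ => t) t (measurable_const.indicator hA) fun x => by
      by_cases hx : x ∈ A <;> simp [hx, abs_of_nonneg ht, ht]
    have h2 : ∫ x, Real.exp (A.indicator (fun _ => t) x) ∂Q = 1 := by
      have : (fun x => Real.exp (A.indicator (fun _ => t) x)) =ᵐ[Q] fun _ => 1 := by
        filter_upwards [measure_eq_zero_iff_ae_notMem.1 hQA] with x hx
        simp [hx]
      rw [integral_congr_ae this]; simp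
    rw [integral_indicator_const _ hA, h2, smul_eq_mul] at h1
    linarith
  by_contra hPA
  have hpos : 0 < P.real A := ENNReal.toReal_pos hPA (measure_ne_top _ _)
  have hK : 0 ≤ K := by simpa using key 0 le_rfl
  have := key ((K + 1) / P.real A) (by positivity)
  rw [div_mul_cancel₀ _ hpos.ne'] at this
  linarith

/-- Truncation of a nonnegative number to `[exp (-n), exp n]`. -/
noncomputable def clampExp (n : ℕ) (y : ℝ) : ℝ := max (Real.exp (-n)) (min (Real.exp n) y)

lemma clampExp_pos (n : ℕ) (y : ℝ) : 0 < clampExp n y :=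
  (Real.exp_pos _).trans_le (le_max_left _ _)

lemma abs_log_clampExp_le (n : ℕ) (y : ℝ) : |Real.log (clampExp n y)| ≤ n := by
  have h : Real.exp (-n : ℝ) ≤ Real.exp n :=
    Real.exp_le_exp.2 (by linarith [n.cast_nonneg (α := ℝ)])
  refine abs_le.2 ⟨(Real.le_log_iff_exp_le (clampExp_pos n y)).2 (le_max_left _ _),
    (Real.log_le_iff_le_exp (clampExp_pos n y)).2 (max_le h (min_le_left _ _))⟩

/-- Clamping moves `y` towards `1`, so both factors have the same sign. -/
lemma sub_mul_log_clampExp_nonneg (n : ℕ) (y : ℝ) :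
    0 ≤ (y - clampExp n y) * Real.log (clampExp n y) := by
  have h : Real.exp (-n : ℝ) ≤ Real.exp n :=
    Real.exp_le_exp.2 (by linarith [n.cast_nonneg (α := ℝ)])
  rcases le_total y (Real.exp (-n)) with hy | hy
  · have : clampExp n y = Real.exp (-n) := max_eq_left ((min_le_right _ _).trans hy)
    rw [this, Real.log_exp]
    nlinarith [n.cast_nonneg (α := ℝ)]
  rcases le_total y (Real.exp n) with hy' | hy'
  · have : clampExp n y = y := by rw [clampExp, min_eq_right hy', max_eq_right hy]
    simp [this]
  · have : clampExp n y = Real.exp n := by rw [clampExp, min_eq_left hy', max_eq_right h]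
    rw [this, Real.log_exp]
    exact mul_nonneg (by linarith) n.cast_nonneg

/-- With `c = clampExp n y` the expression equals `klFun c + (y - c) * log c`. Nonnegativity is what
allows Fatou's lemma for the truncated integrands. -/
lemma truncated_klFun_nonneg (n : ℕ) (y : ℝ) :
    0 ≤ y * Real.log (clampExp n y) - clampExp n y + 1 := by
  have h1 := klFun_nonneg (clampExp_pos n y).le
  have h2 := sub_mul_log_clampExp_nonneg n y
  rw [klFun_apply] at h1
  linarith

lemma tendsto_truncated_klFun {y : ℝ} (hy : 0 ≤ y) :
    Tendsto (fun n : ℕ => y * Real.log (clampExp n y) - clampExp n y + 1) atTop (𝓝 (klFun y)) := by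
  have h0 : Tendsto (fun n : ℕ => Real.exp (-n : ℝ)) atTop (𝓝 0) :=
    Real.tendsto_exp_neg_atTop_nhds_zero.comp tendsto_natCast_atTop_atTop
  have h1 : Tendsto (fun n : ℕ => Real.exp (n : ℝ)) atTop atTop :=
    Real.tendsto_exp_atTop.comp tendsto_natCast_atTop_atTop
  rcases hy.eq_or_lt with rfl | hy
  · have : ∀ n : ℕ, clampExp n 0 = Real.exp (-n : ℝ) := fun n => by
      rw [clampExp, min_eq_right (Real.exp_nonneg _), max_eq_left (Real.exp_nonneg _)]
    simp only [this, zero_mul, klFun_zero, zero_sub]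
    simpa using h0.neg.add_const 1
  · refine tendsto_const_nhds.congr' ?_
    filter_upwards [h0.eventually (ge_mem_nhds hy), h1.eventually_ge_atTop y] with n hn hn'
    rw [clampExp, min_eq_right hn', max_eq_right hn, klFun_apply]
    ring

/-- The hard half of the dual description of the Kullback-Leibler divergence. -/
lemma klDiv_le_of_dual_bound [IsProbabilityMeasure P] [IsProbabilityMeasure Q] {K : ℝ}
    (h : ∀ (f : E → ℝ) (B : ℝ), Measurable f → (∀ x, |f x| ≤ B) →
      ∫ x, f x ∂P - ∫ x, Real.exp (f x) ∂Q + 1 ≤ K) : klDiv P Q ≤ ENNReal.ofReal K := by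
  have hac := absolutelyContinuous_of_dual_bound h
  rw [klDiv_eq_lintegral_klFun_of_ac hac]
  set y : E → ℝ := fun x => (P.rnDeriv Q x).toReal with hy
  have hym : Measurable y := by fun_prop
  have hcm : ∀ n, Measurable fun x => clampExp n (y x) := fun n => by
    unfold clampExp; fun_prop
  let F : ℕ → E → ℝ := fun n x => y x * Real.log (clampExp n (y x)) - clampExp n (y x) + 1
  have hFm : ∀ n, Measurable (F n) := fun n =>
    ((hym.mul (hcm n).log).sub (hcm n)).add_const 1
  have hF : ∀ n, ∫⁻ x, ENNReal.ofReal (F n x) ∂Q ≤ ENNReal.ofReal K := fun n => by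
    have hB : ∀ x, |Real.log (clampExp n (y x))| ≤ n := fun x => abs_log_clampExp_le n _
    have h1 := h (fun x => Real.log (clampExp n (y x))) n (hcm n).log hB
    have hexp := integrable_exp_of_le (P := Q) (hcm n).log fun x => (le_abs_self _).trans (hB x)
    simp only [Real.exp_log (clampExp_pos n _)] at h1 hexp
    have hfP : Integrable (fun x => Real.log (clampExp n (y x))) P :=
      integrable_of_abs_le (hcm n).log hB
    have hmul : Integrable (fun x => y x * Real.log (clampExp n (y x))) Q :=
      (integrable_rnDeriv_smul_iff hac).2 hfP
    have hFi : Integrable (F n) Q := (hmul.sub hexp).add (integrable_const 1)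
    rw [← ofReal_integral_eq_lintegral_ofReal hFi
      (ae_of_all _ fun x => truncated_klFun_nonneg n (y x))]
    refine ENNReal.ofReal_le_ofReal (le_trans (le_of_eq ?_) h1)
    have h2 := integral_add (hmul.sub hexp) (integrable_const (1 : ℝ))
    simp only [Pi.sub_apply, integral_const, probReal_univ, one_smul] at h2
    rw [h2, integral_sub hmul hexp]
    congr 2
    exact integral_rnDeriv_smul hac
  have hlim : ∀ x, ENNReal.ofReal (klFun (y x))
      = liminf (fun n => ENNReal.ofReal (F n x)) atTop := fun x =>
    ((ENNReal.tendsto_ofReal (tendsto_truncated_klFun ENNReal.toReal_nonneg)).liminf_eq).symm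
  calc ∫⁻ x, ENNReal.ofReal (klFun (y x)) ∂Q
      = ∫⁻ x, liminf (fun n => ENNReal.ofReal (F n x)) atTop ∂Q := lintegral_congr hlim
    _ ≤ liminf (fun n => ∫⁻ x, ENNReal.ofReal (F n x) ∂Q) atTop :=
        lintegral_liminf_le fun n => (hFm n).ennreal_ofReal
    _ ≤ ENNReal.ofReal K := by
        refine (liminf_le_liminf (Eventually.of_forall hF)).trans ?_
        simp

end Duality

/-! ### Tightness, lower semicontinuity and weak limits of Gaussian measures -/

section Compactness

open Filter Topology BoundedContinuousFunction

/-- A set of small `Q`-measure has small `P`-measure if `klDiv P Q` is bounded. -/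
lemma mul_measureReal_le_of_klDiv_le {E : Type*} [MeasurableSpace E] {P Q : Measure E}
    [IsProbabilityMeasure P] [IsProbabilityMeasure Q] {K : ℝ} (hK : klDiv P Q ≤ ENNReal.ofReal K)
    (hK0 : 0 ≤ K) {A : Set E} (hA : MeasurableSet A) {t : ℝ} (ht : 0 ≤ t) :
    t * P.real A ≤ K + Real.exp t * Q.real A := by
  have h1 := integral_sub_integral_exp_add_one_le_toReal_klDiv (P := P) (Q := Q)
    (ne_top_of_le_ne_top ENNReal.ofReal_ne_top hK) (f := A.indicator fun _ => t)
    (measurable_const.indicator hA) (B := t) fun x => by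
      by_cases hx : x ∈ A <;> simp [hx, abs_of_nonneg ht, ht]
  have h2 : ∫ x, Real.exp (A.indicator (fun _ => t) x) ∂Q ≤ 1 + Real.exp t * Q.real A := by
    calc ∫ x, Real.exp (A.indicator (fun _ => t) x) ∂Q
        ≤ ∫ x, (1 + A.indicator (fun _ => Real.exp t) x) ∂Q := by
          refine integral_mono_of_nonneg (ae_of_all _ fun _ => Real.exp_nonneg _)
            ((integrable_const 1).add ((integrable_const _).indicator hA))
            (ae_of_all _ fun x => ?_)
          by_cases hx : x ∈ A <;> simp [hx]
      _ = 1 + Real.exp t * Q.real A := by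
          rw [integral_add (integrable_const _) ((integrable_const _).indicator hA),
            integral_indicator_const _ hA]
          simp [mul_comm]
  have h3 : (klDiv P Q).toReal ≤ K := ENNReal.toReal_le_of_le_ofReal hK0 hK
  rw [integral_indicator_const _ hA, smul_eq_mul] at h1
  linarith

lemma isTightMeasureSet_klDiv_le {E : Type*} [MeasurableSpace E] [TopologicalSpace E]
    [PolishSpace E] [BorelSpace E] (Q : Measure E) [IsProbabilityMeasure Q]
    {K : ℝ≥0∞} (hK : K ≠ ∞) :
    IsTightMeasureSet {P : Measure E | IsProbabilityMeasure P ∧ klDiv P Q ≤ K} := by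
  rw [isTightMeasureSet_iff_exists_isCompact_measure_compl_le]
  intro ε hε
  obtain ⟨δ, hδ, hδε⟩ := ENNReal.lt_iff_exists_nnreal_btwn.1 hε
  have hδ0 : (0 : ℝ) < δ := by exact_mod_cast hδ
  -- For a compact `C` with `Q Cᶜ ≤ exp (-t)`, the previous estimate yields `t * P.real Cᶜ ≤ K + 1`,
  -- and `K + 1` is `t * δ`.
  set t : ℝ := (K.toReal + 1) / δ with ht
  have htpos : 0 < t := by positivity
  obtain ⟨C, hC, hQC⟩ := isTightMeasureSet_iff_exists_isCompact_measure_compl_le.1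
    (isTightMeasureSet_singleton (μ := Q)) (ENNReal.ofReal (Real.exp (-t)))
    (ENNReal.ofReal_pos.2 (Real.exp_pos _))
  refine ⟨C, hC, fun P hP => ?_⟩
  obtain ⟨_, hPK⟩ := hP
  have h1 := mul_measureReal_le_of_klDiv_le (K := K.toReal)
    (by rwa [ENNReal.ofReal_toReal hK]) ENNReal.toReal_nonneg hC.isClosed.measurableSet.compl
    htpos.le
  have h2 : Q.real Cᶜ ≤ Real.exp (-t) :=
    ENNReal.toReal_le_of_le_ofReal (Real.exp_nonneg _) (hQC Q rfl)
  have h3 : Real.exp t * Q.real Cᶜ ≤ 1 := by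
    calc _ ≤ Real.exp t * Real.exp (-t) := by gcongr
      _ = 1 := by rw [← Real.exp_add]; simp
  have h4 : P.real Cᶜ ≤ δ := by
    have : t * P.real Cᶜ ≤ t * δ := by
      have : t * δ = K.toReal + 1 := by rw [ht]; field_simp
      linarith
    exact le_of_mul_le_mul_left this htpos
  refine le_trans ?_ hδε.le
  rw [← ENNReal.ofReal_toReal (measure_ne_top P Cᶜ), ← ENNReal.ofReal_coe_nnreal]
  exact ENNReal.ofReal_le_ofReal h4

/-- Lower semicontinuity of the Kullback-Leibler divergence under weak convergence. -/
lemma klDiv_le_of_tendsto {E : Type*} [MetricSpace E] [MeasurableSpace E] [BorelSpace E]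
    {ι : Type*} {l : Filter ι} [l.NeBot] {P : ι → ProbabilityMeasure E} {P₀ : ProbabilityMeasure E}
    (hP : Tendsto P l (𝓝 P₀)) {Q : Measure E} [IsProbabilityMeasure Q] {K : ℝ≥0∞}
    (h : Tendsto (fun i => klDiv (P i : Measure E) Q) l (𝓝 K)) :
    klDiv (P₀ : Measure E) Q ≤ K := by
  rcases eq_or_ne K ∞ with rfl | hK
  · exact le_top
  rw [← ENNReal.ofReal_toReal hK]
  have hreal := (ENNReal.tendsto_toReal hK).comp h
  refine klDiv_le_of_dual_bound fun f B hf hB => dual_bound_of_boundedContinuous (fun g => ?_) hf hB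
  have h1 := ((ProbabilityMeasure.tendsto_iff_forall_integral_tendsto.1 hP g).sub_const
    (∫ x, Real.exp (g x) ∂Q)).add_const 1
  refine le_of_tendsto_of_tendsto h1 hreal ?_
  filter_upwards [h.eventually_ne hK] with i hi
  exact integral_sub_integral_exp_add_one_le_toReal_klDiv hi g.continuous.measurable
    fun x => g.norm_coe_le_norm x

variable {H : Type*} [NormedAddCommGroup H] [InnerProductSpace ℝ H] [MeasurableSpace H]
  [BorelSpace H]

lemma memLp_inner_of_isGaussian (ν : Measure H) [IsGaussian ν] (x : H) :
    MemLp (fun z => ⟪x, z⟫) 2 ν :=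
  IsGaussian.memLp_dual ν (innerSL ℝ x) 2 (by simp)

lemma tendsto_charFun {ι : Type*} {l : Filter ι} {ν : ι → ProbabilityMeasure H}
    {ρ : ProbabilityMeasure H} (hlim : Tendsto ν l (𝓝 ρ)) (x : H) :
    Tendsto (fun i => charFun (ν i : Measure H) x) l (𝓝 (charFun (ρ : Measure H) x)) := by
  rw [ProbabilityMeasure.tendsto_iff_forall_integral_rclike_tendsto ℂ] at hlim
  simp_rw [charFun_eq_integral_innerProbChar]
  exact hlim (innerProbChar x)

variable [CompleteSpace H] [SecondCountableTopology H]

lemma map_inner_eq_gaussianReal (ν : Measure H) [IsGaussian ν] (x : H) :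
    ν.map (fun z => ⟪x, z⟫) =
      gaussianReal ⟪x, ∫ z, z ∂ν⟫ (covarianceBilin ν x x).toNNReal := by
  have h := IsGaussian.map_eq_gaussianReal (μ := ν) (innerSL ℝ x)
  have h2 : ∫ z, innerSL ℝ x z ∂ν = ⟪x, ∫ z, z ∂ν⟫ := by
    simpa using integral_inner (IsGaussian.integrable_id (μ := ν)) x
  rw [h2] at h
  rw [covarianceBilin_self IsGaussian.memLp_two_id]
  exact h

/-- If a Gaussian measure charges a ball by more than `3/4`, then its mean is controlled by its
covariance. -/
lemma abs_inner_mean_le (ν : Measure H) [IsGaussian ν] (x : H) {R B : ℝ}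
    (hR : ν (Metric.closedBall 0 R)ᶜ ≤ 4⁻¹) (hB0 : 0 < B) (hB : covarianceBilin ν x x ≤ B) :
    |⟪x, ∫ z, z ∂ν⟫| ≤ ‖x‖ * R + 2 * √B := by
  by_contra! hlt
  have hc : 0 < 2 * √B := by positivity
  have hcheb := meas_ge_le_variance_div_sq (memLp_inner_of_isGaussian ν x) hc
  have hmean : ∫ z, ⟪x, z⟫ ∂ν = ⟪x, ∫ z, z ∂ν⟫ := integral_inner IsGaussian.integrable_id x
  rw [← covarianceBilin_self IsGaussian.memLp_two_id, hmean, mul_pow, Real.sq_sqrt hB0.le] at hcheb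
  have h4 : ENNReal.ofReal (covarianceBilin ν x x / (2 ^ 2 * B)) ≤ 4⁻¹ := by
    rw [show (4⁻¹ : ℝ≥0∞) = ENNReal.ofReal 4⁻¹ by
      rw [ENNReal.ofReal_inv_of_pos (by norm_num)]; simp]
    apply ENNReal.ofReal_le_ofReal
    rw [div_le_iff₀ (by positivity)]
    linarith
  -- If the mean were too large, every point of the ball would deviate from it by at least `2 * √B`
  -- in the direction `x`. Two sets of measure at most `1/4` would then cover the space.
  have hcover : (Set.univ : Set H) ⊆ (Metric.closedBall 0 R)ᶜ ∪
      {z | 2 * √B ≤ |⟪x, z⟫ - ⟪x, ∫ z, z ∂ν⟫|} := by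
    intro z _
    by_cases hz : z ∈ Metric.closedBall (0 : H) R
    · right
      have h1 : |⟪x, z⟫| ≤ ‖x‖ * R :=
        (abs_real_inner_le_norm x z).trans (by gcongr; simpa using hz)
      have h2 := abs_sub_abs_le_abs_sub ⟪x, ∫ z, z ∂ν⟫ ⟪x, z⟫
      rw [abs_sub_comm] at h2
      simp only [Set.mem_ofPred_eq]
      linarith
    · exact Or.inl hz
  have h1 : (1 : ℝ≥0∞) ≤ 4⁻¹ + 4⁻¹ := by
    calc (1 : ℝ≥0∞) = ν Set.univ := measure_univ.symm
      _ ≤ _ := measure_mono hcover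
      _ ≤ _ := measure_union_le _ _
      _ ≤ _ := add_le_add hR (hcheb.trans h4)
  have h2 := ENNReal.toReal_mono (by simp) h1
  rw [ENNReal.toReal_add (by simp) (by simp)] at h2
  norm_num at h2

lemma exists_tendsto_of_eventually_abs_le {ι : Type*} {U : Ultrafilter ι} {f : ι → ℝ} {B : ℝ}
    (h : ∀ᶠ i in U, |f i| ≤ B) : ∃ a, Tendsto f U (𝓝 a) := by
  obtain ⟨a, -, ha⟩ := (isCompact_Icc (a := -B) (b := B)).ultrafilter_le_nhds (U.map f) (by
    rw [le_principal_iff]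
    exact h.mono fun i hi => abs_le.1 hi)
  exact ⟨a, ha⟩

section Limit

variable {ι : Type*} {U : Ultrafilter ι} {ν : ι → ProbabilityMeasure H} {ρ : ProbabilityMeasure H}

/-- The modulus of a Gaussian characteristic function at `t • x` is `exp (-t² σ² / 2)`, with `σ²`
the variance along `x`. It converges to that of `ρ`, which is near `1` for small `t`, so `σ²` cannot
escape to infinity. -/
lemma eventually_covarianceBilin_le (hν : ∀ i, IsGaussian (ν i : Measure H))
    (hlim : Tendsto ν U (𝓝 ρ)) (x : H) :
    ∃ B : ℝ, 0 < B ∧ ∀ᶠ i in U, covarianceBilin (ν i : Measure H) x x ≤ B := by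
  have hcont : Tendsto (fun t : ℝ => ‖charFun (ρ : Measure H) (t • x)‖) (𝓝[>] 0) (𝓝 1) := by
    have h1 : Continuous fun t : ℝ => ‖charFun (ρ : Measure H) (t • x)‖ := by fun_prop
    have h2 := h1.tendsto 0
    simp only [zero_smul, charFun_zero, probReal_univ, Complex.ofReal_one, norm_one] at h2
    exact h2.mono_left nhdsWithin_le_nhds
  obtain ⟨t, ht, ht0⟩ := ((hcont.eventually_const_lt (u := Real.exp (-1))
    (by rw [Real.exp_lt_one_iff]; norm_num)).and self_mem_nhdsWithin).exists
  have ht0 : 0 < t := ht0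
  -- A modulus above `exp (-1)` means `t² σ² / 2 < 1`.
  refine ⟨2 / t ^ 2, by positivity, ?_⟩
  filter_upwards [(tendsto_charFun hlim (t • x)).norm.eventually_const_lt ht] with i hi
  have := hν i
  rw [IsGaussian.charFun_eq', Complex.norm_exp] at hi
  simp only [map_smul, _root_.smul_apply, smul_eq_mul] at hi
  have h3 := Real.exp_lt_exp.1 hi
  simp at h3
  rw [le_div_iff₀ (by positivity)]
  nlinarith

/-- Tightness bounds the means once the variances are bounded, and bounded real families converge
along an ultrafilter. The limiting characteristic function is then that of a real Gaussian, possibly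
degenerate. -/
lemma exists_tendsto_params (hν : ∀ i, IsGaussian (ν i : Measure H))
    (hlim : Tendsto ν U (𝓝 ρ))
    (htight : IsTightMeasureSet (Set.range fun i => (ν i : Measure H))) (x : H) :
    ∃ m v : ℝ, Tendsto (fun i => ⟪x, ∫ z, z ∂(ν i : Measure H)⟫) U (𝓝 m) ∧
      Tendsto (fun i => covarianceBilin (ν i : Measure H) x x) U (𝓝 v) ∧ 0 ≤ v ∧
      (ρ : Measure H).map (fun z => ⟪x, z⟫) = gaussianReal m v.toNNReal := by
  obtain ⟨B, hB0, hB⟩ := eventually_covarianceBilin_le hν hlim x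
  obtain ⟨C, hC, hCν⟩ := isTightMeasureSet_iff_exists_isCompact_measure_compl_le.1 htight 4⁻¹
    (by simp)
  obtain ⟨R, hR⟩ := hC.isBounded.subset_closedBall 0
  obtain ⟨v, hv⟩ := exists_tendsto_of_eventually_abs_le (f := fun i =>
    covarianceBilin (ν i : Measure H) x x) (hB.mono fun i hi => by
      rwa [abs_of_nonneg (covarianceBilin_self_nonneg x)])
  obtain ⟨m, hm⟩ := exists_tendsto_of_eventually_abs_le (f := fun i =>
    ⟪x, ∫ z, z ∂(ν i : Measure H)⟫) (hB.mono fun i hi => by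
      have := hν i
      exact abs_inner_mean_le (ν i : Measure H) x ((measure_mono
        (Set.compl_subset_compl.2 hR)).trans (hCν _ ⟨i, rfl⟩)) hB0 hi)
  have hv0 : 0 ≤ v := ge_of_tendsto' hv fun i => covarianceBilin_self_nonneg x
  refine ⟨m, v, hm, hv, hv0, ?_⟩
  have : IsProbabilityMeasure ((ρ : Measure H).map (fun z => ⟪x, z⟫)) :=
    Measure.isProbabilityMeasure_map (by fun_prop)
  refine Measure.ext_of_charFun (funext fun t => ?_)
  have h1 : charFun ((ρ : Measure H).map (fun z => ⟪x, z⟫)) t = charFun (ρ : Measure H) (t • x) := by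
    rw [charFun_apply_real, integral_map (by fun_prop) (by fun_prop), charFun_apply]
    simp [real_inner_smul_right, real_inner_comm]
  rw [h1, charFun_gaussianReal, Real.coe_toNNReal _ hv0]
  refine tendsto_nhds_unique (tendsto_charFun hlim (t • x)) ?_
  have h2 : ∀ i, charFun (ν i : Measure H) (t • x) =
      Complex.exp (t * (⟪x, ∫ z, z ∂(ν i : Measure H)⟫ : ℝ) * Complex.I
        - (covarianceBilin (ν i : Measure H) x x : ℝ) * t ^ 2 / 2) := fun i => by
    have := hν i
    rw [IsGaussian.charFun_eq']
    simp [real_inner_smul_left]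
    ring_nf
  simp_rw [h2]
  refine (Complex.continuous_exp.tendsto _).comp ?_
  refine Tendsto.sub ?_ ?_
  · exact (((Complex.continuous_ofReal.tendsto m).comp hm).const_mul _).mul_const _
  · exact ((((Complex.continuous_ofReal.tendsto v).comp hv).mul_const _).div_const _)

/-- Weak limits of Gaussian measures are Gaussian. -/
lemma isGaussian_of_tendsto (hν : ∀ i, IsGaussian (ν i : Measure H)) (hlim : Tendsto ν U (𝓝 ρ))
    (htight : IsTightMeasureSet (Set.range fun i => (ν i : Measure H))) :
    IsGaussian (ρ : Measure H) := by
  refine isGaussian_of_map_eq_gaussianReal fun L => ?_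
  obtain ⟨m, v, -, -, -, h⟩ :=
    exists_tendsto_params hν hlim htight ((InnerProductSpace.toDual ℝ H).symm L)
  simp only [InnerProductSpace.toDual_symm_apply] at h
  exact ⟨m, _, h⟩

lemma tendsto_mean_and_covarianceBilin (hν : ∀ i, IsGaussian (ν i : Measure H))
    (hlim : Tendsto ν U (𝓝 ρ))
    (htight : IsTightMeasureSet (Set.range fun i => (ν i : Measure H))) (x : H) :
    Tendsto (fun i => ⟪x, ∫ z, z ∂(ν i : Measure H)⟫) U (𝓝 ⟪x, ∫ z, z ∂(ρ : Measure H)⟫) ∧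
      Tendsto (fun i => covarianceBilin (ν i : Measure H) x x) U
        (𝓝 (covarianceBilin (ρ : Measure H) x x)) := by
  have := isGaussian_of_tendsto hν hlim htight
  obtain ⟨m, v, hm, hv, hv0, h⟩ := exists_tendsto_params hν hlim htight x
  rw [map_inner_eq_gaussianReal, gaussianReal_ext_iff,
    Real.toNNReal_eq_toNNReal_iff (covarianceBilin_self_nonneg x) hv0] at h
  rw [h.1, h.2]
  exact ⟨hm, hv⟩

end Limit

end Compactness

/-! ### Simultaneous diagonalisation and finite-dimensional projections -/

section LinearAlgebra

/-- Simultaneous diagonalisation of two symmetric bilinear forms, one of them positive definite. -/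
lemma exists_basis_simultaneously_diagonal {V : Type*} [AddCommGroup V] [Module ℝ V]
    [FiniteDimensional ℝ V] (B₁ B₂ : LinearMap.BilinForm ℝ V)
    (h₁ : ∀ x y, B₁ x y = B₁ y x) (h₂ : ∀ x y, B₂ x y = B₂ y x) (hpos : ∀ x, x ≠ 0 → 0 < B₁ x x) :
    ∃ b : Module.Basis (Fin (Module.finrank ℝ V)) ℝ V,
      (∀ i j, B₁ (b i) (b j) = if i = j then 1 else 0) ∧ ∀ i j, i ≠ j → B₂ (b i) (b j) = 0 := by
  have hnonneg : ∀ x, 0 ≤ B₁ x x := fun x => by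
    rcases eq_or_ne x 0 with rfl | hx
    · simp
    · exact (hpos x hx).le
  let core : InnerProductSpace.Core ℝ V :=
    { inner := fun x y => B₁ x y
      conj_inner_symm := fun x y => by simpa using h₁ y x
      re_inner_nonneg := fun x => by simpa using hnonneg x
      add_left := fun x y z => by simp
      smul_left := fun x y r => by simp
      definite := fun x hx => by
        by_contra hne
        exact (hpos x hne).ne' hx }
  let : NormedAddCommGroup V := core.toNormedAddCommGroup
  let : InnerProductSpace ℝ V := InnerProductSpace.ofCore core.toCore
  have hinner : ∀ x y : V, ⟪x, y⟫ = B₁ x y := fun _ _ => rfl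
  have hnd : B₁.Nondegenerate := by
    refine ⟨fun x hx => ?_, fun x hx => ?_⟩ <;>
    · by_contra hne
      exact (hpos x hne).ne' (hx x)
  -- With `B₁` as inner product, `T` represents `B₂` and is symmetric. An orthonormal eigenbasis of
  -- `T` diagonalises both forms.
  let T : V →ₗ[ℝ] V := (B₁.toDual hnd).symm.toLinearMap ∘ₗ B₂
  have hT : ∀ x y, ⟪T x, y⟫ = B₂ x y := fun x y => by
    rw [hinner]
    exact LinearMap.BilinForm.apply_toDual_symm_apply (hB := hnd) (B₂ x) y
  have hsymm : T.IsSymmetric := fun x y => by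
    rw [hT, real_inner_comm, hT, h₂]
  let e := hsymm.eigenvectorBasis rfl
  refine ⟨e.toBasis, fun i j => ?_, fun i j hij => ?_⟩
  · rw [← hinner]
    simpa using orthonormal_iff_ite.1 e.orthonormal i j
  · rw [← hT]
    simp only [OrthonormalBasis.coe_toBasis]
    rw [show T (e i) = _ from hsymm.apply_eigenvectorBasis rfl i, inner_smul_left]
    simp [e.orthonormal.2 hij, e]

variable {H : Type*} [NormedAddCommGroup H] [InnerProductSpace ℝ H]

lemma exists_family_simultaneously_diagonal (V : Submodule ℝ H) [FiniteDimensional ℝ V]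
    (B₁ B₂ : H →L[ℝ] H →L[ℝ] ℝ) (h₁ : ∀ x y, B₁ x y = B₁ y x) (h₂ : ∀ x y, B₂ x y = B₂ y x)
    (hpos : ∀ x, x ≠ 0 → 0 < B₁ x x) :
    ∃ u : Fin (Module.finrank ℝ V) → H, Submodule.span ℝ (Set.range u) = V ∧
      (∀ i j, B₁ (u i) (u j) = if i = j then 1 else 0) ∧ ∀ i j, i ≠ j → B₂ (u i) (u j) = 0 := by
  obtain ⟨b, hb₁, hb₂⟩ := exists_basis_simultaneously_diagonal (V := V)
    (B₁.toBilinForm.restrict V) (B₂.toBilinForm.restrict V)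
    (fun x y => h₁ x y) (fun x y => h₂ x y) (fun x hx => hpos x (by simpa using hx))
  refine ⟨fun i => b i, ?_, fun i j => hb₁ i j, fun i j => hb₂ i j⟩
  rw [show (fun i => (b i : H)) = V.subtype ∘ b from rfl, Set.range_comp, Submodule.span_image,
    b.span_eq, Submodule.map_top, Submodule.range_subtype]

/-- The orthogonal projection onto the span of a finite family is a continuous function of the
inner products with the family. -/
lemma exists_continuous_starProjection_eq {ι : Type*} [Finite ι] (u : ι → H) (V : Submodule ℝ H)
    [V.HasOrthogonalProjection] (hV : Submodule.span ℝ (Set.range u) = V) :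
    ∃ S : (ι → ℝ) → H, Continuous S ∧ ∀ z, S (fun i => ⟪u i, z⟫) = V.starProjection z := by
  let T : V →ₗ[ℝ] (ι → ℝ) := (LinearMap.pi fun i => (innerSL ℝ (u i)).toLinearMap) ∘ₗ V.subtype
  have huV : ∀ i, u i ∈ V := fun i => hV ▸ Submodule.subset_span ⟨i, rfl⟩
  have hT : LinearMap.ker T = ⊥ := by
    rw [LinearMap.ker_eq_bot']
    intro x hx
    have h0 : ∀ i, ⟪u i, (x : H)⟫ = 0 := fun i => congrFun hx i
    have h1 : (x : H) ∈ Vᗮ := by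
      rw [Submodule.mem_orthogonal]
      intro w hw
      rw [← hV] at hw
      induction hw using Submodule.span_induction with
      | mem w hw => obtain ⟨i, rfl⟩ := hw; exact h0 i
      | zero => simp
      | add a b _ _ ha hb => rw [inner_add_left, ha, hb, add_zero]
      | smul r a _ ha => rw [inner_smul_left, ha, mul_zero]
    have h2 : ⟪(x : H), (x : H)⟫ = 0 := Submodule.inner_right_of_mem_orthogonal x.2 h1
    exact Subtype.ext (inner_self_eq_zero.1 h2)
  obtain ⟨S, hS⟩ := T.exists_leftInverse_of_injective hT
  refine ⟨fun y => (V.subtype ∘ₗ S) y, LinearMap.continuous_of_finiteDimensional _, fun z => ?_⟩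
  have h1 : (fun i => ⟪u i, z⟫) = T (V.orthogonalProjectionOnto z) := by
    ext i
    change ⟪u i, z⟫ = ⟪u i, V.starProjection z⟫
    rw [← Submodule.inner_starProjection_left_eq_right,
      Submodule.starProjection_eq_self_iff.2 (huV i)]
  rw [h1]
  exact congrArg Subtype.val (LinearMap.congr_fun hS (V.orthogonalProjectionOnto z))

end LinearAlgebra

/-! ### Hellinger affinity -/

section Hellinger

/-- If `P ≪ Q`, then the Hellinger affinity of `P` and `Q` is positive; by the Cauchy-Schwarz
inequality this bounds from below the product of the integrals of `G` and `G⁻¹`. -/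
lemma exists_pos_le_lintegral_mul_lintegral_inv {E : Type*} [MeasurableSpace E] {P Q : Measure E}
    [IsProbabilityMeasure P] [IsProbabilityMeasure Q] (hPQ : P ≪ Q) :
    ∃ c : ℝ, 0 < c ∧ ∀ G : E → ℝ≥0∞, Measurable G → (∀ x, G x ≠ 0) → (∀ x, G x ≠ ∞) →
      ENNReal.ofReal c ≤ (∫⁻ x, G x ∂P) * ∫⁻ x, (G x)⁻¹ ∂Q := by
  set h := P.rnDeriv Q
  have hm : Measurable h := Measure.measurable_rnDeriv P Q
  have hne : (∫⁻ x, h x ^ (2⁻¹ : ℝ) ∂Q) ≠ 0 := fun h0 => by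
    rw [lintegral_eq_zero_iff (by fun_prop)] at h0
    have h1 : h =ᵐ[Q] 0 := h0.mono fun x hx => 
      (ENNReal.rpow_eq_zero_iff_of_pos (by norm_num)).1 hx
    have h2 : P Set.univ = 0 := by
      rw [← Measure.withDensity_rnDeriv_eq P Q hPQ, withDensity_apply _ MeasurableSet.univ,
        setLIntegral_univ, lintegral_congr_ae h1]
      simp
    simp at h2
  -- Any `c` strictly between `0` and the squared affinity `(∫ √h dQ)²` works: Cauchy-Schwarz is
  -- applied to `√h = √(h G) * √(G⁻¹)`.
  obtain ⟨c, hc0, hc⟩ := ENNReal.lt_iff_exists_nnreal_btwn.1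
    (pos_iff_ne_zero.2 (mul_ne_zero hne hne))
  refine ⟨c, by exact_mod_cast hc0, fun G hG hG0 hGt => ?_⟩
  rw [ENNReal.ofReal_coe_nnreal]
  refine hc.le.trans ?_
  have hconj : Real.HolderConjugate 2 2 := Real.HolderConjugate.two_two
  have h3 := ENNReal.lintegral_mul_le_Lp_mul_Lq Q hconj
    (f := fun x => (h x * G x) ^ (2⁻¹ : ℝ)) (g := fun x => (G x)⁻¹ ^ (2⁻¹ : ℝ))
    (by fun_prop) (by fun_prop)
  have h4 : ∀ x, ((fun x => (h x * G x) ^ (2⁻¹ : ℝ)) * fun x => (G x)⁻¹ ^ (2⁻¹ : ℝ)) x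
      = h x ^ (2⁻¹ : ℝ) := fun x => by
    rw [Pi.mul_apply, ← ENNReal.mul_rpow_of_nonneg _ _ (by norm_num), mul_assoc,
      ENNReal.mul_inv_cancel (hG0 x) (hGt x), mul_one]
  have h5 : ∀ y : ℝ≥0∞, (y ^ (2⁻¹ : ℝ)) ^ (2 : ℝ) = y := fun y => by
    rw [← ENNReal.rpow_mul]; norm_num
  have h6 : ∀ y : ℝ≥0∞, y ^ (1 / 2 : ℝ) * y ^ (1 / 2 : ℝ) = y := fun y => by
    rw [← ENNReal.rpow_add_of_nonneg _ _ (by norm_num) (by norm_num)]; norm_num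
  simp only [h4, h5] at h3
  have h7 : ∫⁻ x, h x * G x ∂Q = ∫⁻ x, G x ∂P := lintegral_rnDeriv_mul hPQ hG.aemeasurable
  rw [h7] at h3
  calc _ ≤ _ := mul_le_mul' h3 h3
    _ = _ := by rw [mul_mul_mul_comm, h6, h6]

end Hellinger

/-! ### Entropy and affinity of real Gaussian measures -/

section RealGaussian

open scoped NNReal

/-- The logarithm of the density of `N(0, 1)` with respect to `N(m, v)`. -/
noncomputable def gaussianLogRatio (m : ℝ) (v : ℝ≥0) (x : ℝ) : ℝ :=
  Real.log v / 2 - x ^ 2 / 2 + (x - m) ^ 2 / (2 * v)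

/-- The Kullback-Leibler divergence of `N(0, 1)` with respect to `N(m, v)`. -/
noncomputable def gaussianEntropy (m : ℝ) (v : ℝ≥0) : ℝ :=
  Real.log v / 2 - 1 / 2 + (1 + m ^ 2) / (2 * v)

/-- The Hellinger affinity of `N(0, 1)` and `N(m, v)`. -/
noncomputable def gaussianAffinity (m : ℝ) (v : ℝ≥0) : ℝ :=
  Real.exp (-(Real.log v / 4)) * √(2 * v / (1 + v)) * Real.exp (-(m ^ 2 / (4 * (1 + v))))

variable {m : ℝ} {v : ℝ≥0}

@[fun_prop]
lemma continuous_gaussianLogRatio : Continuous (gaussianLogRatio m v) := by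
  unfold gaussianLogRatio; fun_prop

lemma gaussianAffinity_pos (hv : v ≠ 0) : 0 < gaussianAffinity m v := by
  have : 0 < v := pos_iff_ne_zero.2 hv
  unfold gaussianAffinity; positivity

lemma gaussianPDFReal_eq_mul_exp (hv : v ≠ 0) (x : ℝ) :
    gaussianPDFReal m v x = gaussianPDFReal 0 1 x * Real.exp (-gaussianLogRatio m v x) := by
  have hv' : (0 : ℝ) < v := by exact_mod_cast pos_iff_ne_zero.2 hv
  have hs : Real.exp (-(Real.log v / 2)) = (√v)⁻¹ := by
    rw [Real.exp_neg, Real.exp_half, Real.exp_log hv']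
  rw [gaussianPDFReal, gaussianPDFReal, gaussianLogRatio,
    show -(Real.log v / 2 - x ^ 2 / 2 + (x - m) ^ 2 / (2 * v))
      = -(Real.log v / 2) + (x ^ 2 / 2 + -(x - m) ^ 2 / (2 * v)) by ring,
    Real.exp_add, hs, Real.exp_add, Real.sqrt_mul (by positivity) (v : ℝ), mul_inv]
  have h1 : Real.exp (-(x - 0) ^ 2 / (2 * (1 : ℝ≥0))) * Real.exp (x ^ 2 / 2) = 1 := by
    rw [← Real.exp_add]; simp; ring
  simp only [NNReal.coe_one, mul_one] at h1 ⊢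
  linear_combination (-(√(2 * Real.pi))⁻¹ * (√v)⁻¹ * Real.exp (-(x - m) ^ 2 / (2 * v))) * h1

lemma gaussianReal_eq_withDensity (hv : v ≠ 0) :
    gaussianReal m v = (gaussianReal 0 1).withDensity
      fun x => ENNReal.ofReal (Real.exp (-gaussianLogRatio m v x)) := by
  rw [gaussianReal_of_var_ne_zero _ hv, gaussianReal_of_var_ne_zero _ one_ne_zero,
    ← withDensity_mul _ (measurable_gaussianPDF 0 1) (by fun_prop)]
  congr 1
  ext x
  rw [Pi.mul_apply, gaussianPDF, gaussianPDF, gaussianPDFReal_eq_mul_exp hv,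
    ENNReal.ofReal_mul (gaussianPDFReal_nonneg _ _ _)]

/-- The left side is the geometric mean of the two densities. Completing the square makes it a
multiple of a Gaussian density, and the factor is the affinity. -/
lemma gaussianPDFReal_mul_exp_half (hv : v ≠ 0) (x : ℝ) :
    gaussianPDFReal 0 1 x * Real.exp (-(gaussianLogRatio m v x / 2)) =
      gaussianAffinity m v * gaussianPDFReal (m / (1 + v)) (2 * v / (1 + v)) x := by
  have hv' : (0 : ℝ) < v := by exact_mod_cast pos_iff_ne_zero.2 hv
  have hs : (√(2 * v / (1 + v)) : ℝ) ≠ 0 := by positivity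
  rw [gaussianPDFReal, gaussianPDFReal, gaussianLogRatio, gaussianAffinity]
  push_cast
  rw [Real.sqrt_mul (by positivity) (2 * v / (1 + v) : ℝ), mul_one, mul_inv]
  have h1 : Real.exp (-(x - 0) ^ 2 / (2 * 1)) *
      Real.exp (-((Real.log v / 2 - x ^ 2 / 2 + (x - m) ^ 2 / (2 * v)) / 2)) =
      Real.exp (-(Real.log v / 4)) * Real.exp (-(m ^ 2 / (4 * (1 + v)))) *
        Real.exp (-(x - m / (1 + v)) ^ 2 / (2 * (2 * v / (1 + v)))) := by
    rw [← Real.exp_add, ← Real.exp_add, ← Real.exp_add]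
    congr 1
    field_simp
    ring
  have h2 : √(2 * v / (1 + v) : ℝ) * (√(2 * v / (1 + v)))⁻¹ = 1 := mul_inv_cancel₀ hs
  simp only [mul_one] at h1 ⊢
  linear_combination (√(2 * Real.pi))⁻¹ * h1 - (Real.exp (-(Real.log v / 4)) *
    Real.exp (-(m ^ 2 / (4 * (1 + v)))) *
    Real.exp (-(x - m / (1 + v)) ^ 2 / (2 * (2 * v / (1 + v)))) * (√(2 * Real.pi))⁻¹) * h2

lemma lintegral_exp_neg_half_gaussianLogRatio (hv : v ≠ 0) :
    ∫⁻ x, ENNReal.ofReal (Real.exp (-(gaussianLogRatio m v x / 2))) ∂gaussianReal 0 1 =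
      ENNReal.ofReal (gaussianAffinity m v) := by
  have hw : 2 * v / (1 + v) ≠ 0 := by
    have : 0 < v := pos_iff_ne_zero.2 hv
    positivity
  rw [gaussianReal_of_var_ne_zero _ one_ne_zero,
    lintegral_withDensity_eq_lintegral_mul _ (measurable_gaussianPDF 0 1) (by fun_prop)]
  have h1 : ∀ x, (gaussianPDF 0 1 * fun x =>
      ENNReal.ofReal (Real.exp (-(gaussianLogRatio m v x / 2)))) x =
      ENNReal.ofReal (gaussianAffinity m v) * gaussianPDF (m / (1 + v)) (2 * v / (1 + v)) x :=
    fun x => by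
      rw [Pi.mul_apply, gaussianPDF, gaussianPDF,
        ← ENNReal.ofReal_mul (gaussianPDFReal_nonneg _ _ _), gaussianPDFReal_mul_exp_half hv,
        ENNReal.ofReal_mul (gaussianAffinity_pos hv).le]
  rw [lintegral_congr h1, lintegral_const_mul _ (measurable_gaussianPDF _ _),
    lintegral_gaussianPDF_eq_one _ hw, mul_one]

lemma integrable_pow_gaussianReal (k : ℕ) (a : ℝ) :
    Integrable (fun x => (x - a) ^ k) (gaussianReal 0 1) := by
  have h : MemLp (fun x : ℝ => x - a) k (gaussianReal 0 1) :=
    (memLp_id_gaussianReal' k (by simp)).sub (memLp_const a)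
  refine (integrable_norm_iff (by fun_prop)).1 ?_
  simpa only [norm_pow] using h.integrable_norm_pow'

lemma integrable_gaussianLogRatio : Integrable (gaussianLogRatio m v) (gaussianReal 0 1) := by
  have h0 := integrable_pow_gaussianReal 2 0
  simp only [sub_zero] at h0
  exact ((integrable_const _).sub (h0.div_const 2)).add
    ((integrable_pow_gaussianReal 2 m).div_const _)

lemma integral_gaussianLogRatio :
    ∫ x, gaussianLogRatio m v x ∂gaussianReal 0 1 = gaussianEntropy m v := by
  have h1 : ∫ x, x ∂gaussianReal 0 1 = 0 := integral_id_gaussianReal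
  have h2 : ∫ x, x ^ 2 ∂gaussianReal 0 1 = 1 := by
    have h := variance_fun_id_gaussianReal (μ := 0) (v := 1)
    rw [variance_eq_integral (by fun_prop), h1] at h
    simpa using h
  have i1 : Integrable (fun x : ℝ => x) (gaussianReal 0 1) := by
    simpa using integrable_pow_gaussianReal 1 0
  have i2 : Integrable (fun x : ℝ => x ^ 2) (gaussianReal 0 1) := by
    simpa using integrable_pow_gaussianReal 2 0
  have h3 : ∀ x, gaussianLogRatio m v x = (1 / (2 * v) - 1 / 2) * x ^ 2 + (-m / v) * x
      + (Real.log v / 2 + m ^ 2 / (2 * v)) := fun x => by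
    unfold gaussianLogRatio; ring
  simp_rw [h3]
  have i3 := (i2.const_mul (1 / (2 * v) - 1 / 2 : ℝ)).add (i1.const_mul (-m / v : ℝ))
  have h4 := integral_add i3 (integrable_const (Real.log v / 2 + m ^ 2 / (2 * v)))
  simp only [Pi.add_apply] at h4
  rw [h4, integral_add (i2.const_mul _) (i1.const_mul _), integral_const_mul, integral_const_mul,
    h1, h2]
  simp [gaussianEntropy]
  ring

lemma gaussianEntropy_nonneg (hv : v ≠ 0) : 0 ≤ gaussianEntropy m v := by
  have hv' : (0 : ℝ) < v := by exact_mod_cast pos_iff_ne_zero.2 hv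
  have h := Real.one_sub_inv_le_log_of_pos hv'
  have h2 : gaussianEntropy m v = (Real.log v - (1 - (v : ℝ)⁻¹)) / 2 + m ^ 2 / (2 * v) := by
    unfold gaussianEntropy; field_simp; ring
  rw [h2]
  have : 0 ≤ m ^ 2 / (2 * v) := by positivity
  linarith

/-- This compares an additive quantity with a multiplicative one with no loss of constants, so that
it survives products over any number of coordinates. -/
lemma one_add_gaussianEntropy_le (hv : v ≠ 0) :
    1 + gaussianEntropy m v / 2 ≤ (gaussianAffinity m v ^ 4)⁻¹ := by
  have hv' : (0 : ℝ) < v := by exact_mod_cast pos_iff_ne_zero.2 hv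
  have h1 : (gaussianAffinity m v ^ 4)⁻¹ =
      (1 + v) ^ 2 / (4 * v) * Real.exp (m ^ 2 / (1 + v)) := by
    have e1 : Real.exp (-(Real.log v / 4)) ^ 4 = (v : ℝ)⁻¹ := by
      rw [← Real.exp_nat_mul]
      push_cast
      rw [show (4 : ℝ) * -(Real.log v / 4) = -Real.log v by ring, Real.exp_neg, Real.exp_log hv']
    have e2 : √(2 * v / (1 + v) : ℝ) ^ 4 = (2 * v / (1 + v)) ^ 2 := by
      rw [show 4 = 2 * 2 from rfl, pow_mul, Real.sq_sqrt (by positivity)]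
    have e3 : Real.exp (-(m ^ 2 / (4 * (1 + v)))) ^ 4 = (Real.exp (m ^ 2 / (1 + v)))⁻¹ := by
      rw [← Real.exp_nat_mul, ← Real.exp_neg]
      congr 1; push_cast; field_simp
    rw [gaussianAffinity, mul_pow, mul_pow, e1, e2, e3]
    field_simp
    ring
  have h2 : 1 + m ^ 2 / (1 + v) ≤ Real.exp (m ^ 2 / (1 + v)) := by
    rw [add_comm]; exact Real.add_one_le_exp _
  have h3 : Real.log v ≤ v - 1 := Real.log_le_sub_one_of_pos hv'
  rw [h1]
  -- After `log v ≤ v - 1`, the case `m = 0` is an identity. In general the gap in the middle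
  -- inequality is exactly `m ^ 2 / 4`.
  calc 1 + gaussianEntropy m v / 2
      ≤ 1 + (((v : ℝ) - 1) / 2 - 1 / 2 + (1 + m ^ 2) / (2 * v)) / 2 := by
        unfold gaussianEntropy; linarith
    _ ≤ (1 + v) ^ 2 / (4 * v) * (1 + m ^ 2 / (1 + v)) := by
        rw [← sub_nonneg]
        have : (1 + v : ℝ) ^ 2 / (4 * v) * (1 + m ^ 2 / (1 + v)) -
            (1 + (((v : ℝ) - 1) / 2 - 1 / 2 + (1 + m ^ 2) / (2 * v)) / 2) = m ^ 2 / 4 := by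
          field_simp
          ring
        rw [this]; positivity
    _ ≤ _ := by gcongr

end RealGaussian

/-! ### Products of real Gaussian measures -/

section ProductGaussian

open scoped NNReal

variable {ι : Type*} [Fintype ι] {m : ι → ℝ} {v : ι → ℝ≥0}

lemma lintegral_pi_prod_eq_prod {μ : ι → Measure ℝ} [∀ i, IsProbabilityMeasure (μ i)]
    {f : ι → ℝ → ℝ≥0∞} (hf : ∀ i, Measurable (f i)) :
    ∫⁻ y, ∏ i, f i (y i) ∂Measure.pi μ = ∏ i, ∫⁻ x, f i x ∂μ i := by
  have h := lintegral_prod_eq_prod_lintegral_of_indepFun Finset.univ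
    (fun i (y : ι → ℝ) => f i (y i)) (iIndepFun_pi (μ := μ) fun i => (hf i).aemeasurable)
    fun i => (hf i).comp (measurable_pi_apply i)
  rw [h]
  refine Finset.prod_congr rfl fun i _ => ?_
  exact (measurePreserving_eval μ i).lintegral_comp (hf i)

lemma pi_gaussianReal_eq_withDensity (hv : ∀ i, v i ≠ 0) :
    Measure.pi (fun i => gaussianReal (m i) (v i)) =
      (Measure.pi fun _ : ι => gaussianReal 0 1).withDensity
        fun y => ENNReal.ofReal (Real.exp (-∑ i, gaussianLogRatio (m i) (v i) (y i))) := by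
  refine Measure.pi_eq fun s hs => ?_
  rw [withDensity_apply _ (MeasurableSet.univ_pi hs),
    ← lintegral_indicator (MeasurableSet.univ_pi hs)]
  have h1 : ∀ y : ι → ℝ, (Set.univ.pi s).indicator (fun y => ENNReal.ofReal
      (Real.exp (-∑ i, gaussianLogRatio (m i) (v i) (y i)))) y =
      ∏ i, (s i).indicator (fun x => ENNReal.ofReal
        (Real.exp (-gaussianLogRatio (m i) (v i) x))) (y i) := fun y => by
    by_cases hy : y ∈ Set.univ.pi s
    · rw [Set.indicator_of_mem hy, ← Finset.sum_neg_distrib, Real.exp_sum,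
        ENNReal.ofReal_prod_of_nonneg fun i _ => Real.exp_nonneg _]
      refine Finset.prod_congr rfl fun i _ => ?_
      rw [Set.indicator_of_mem (hy i trivial)]
    · rw [Set.indicator_of_notMem hy]
      simp only [Set.mem_pi, Set.mem_univ, true_imp_iff, not_forall] at hy
      obtain ⟨i, hi⟩ := hy
      exact (Finset.prod_eq_zero (Finset.mem_univ i) (Set.indicator_of_notMem hi _)).symm
  rw [lintegral_congr h1, lintegral_pi_prod_eq_prod fun i => by
    exact Measurable.indicator (by fun_prop) (hs i)]
  refine Finset.prod_congr rfl fun i _ => ?_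
  rw [lintegral_indicator (hs i), gaussianReal_eq_withDensity (hv i),
    withDensity_apply _ (hs i)]

lemma lintegral_pi_exp_neg_half (hv : ∀ i, v i ≠ 0) :
    ∫⁻ y, ENNReal.ofReal (Real.exp (-((∑ i, gaussianLogRatio (m i) (v i) (y i)) / 2)))
      ∂(Measure.pi fun _ : ι => gaussianReal 0 1) =
      ENNReal.ofReal (∏ i, gaussianAffinity (m i) (v i)) := by
  have h1 : ∀ y : ι → ℝ,
      ENNReal.ofReal (Real.exp (-((∑ i, gaussianLogRatio (m i) (v i) (y i)) / 2))) =
      ∏ i, ENNReal.ofReal (Real.exp (-(gaussianLogRatio (m i) (v i) (y i) / 2))) := fun y => by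
    rw [Finset.sum_div, ← Finset.sum_neg_distrib, Real.exp_sum,
      ENNReal.ofReal_prod_of_nonneg fun i _ => Real.exp_nonneg _]
  rw [lintegral_congr h1, lintegral_pi_prod_eq_prod
    (f := fun i x => ENNReal.ofReal (Real.exp (-(gaussianLogRatio (m i) (v i) x / 2))))
    (fun i => by fun_prop),
    ENNReal.ofReal_prod_of_nonneg fun i _ => (gaussianAffinity_pos (hv i)).le]
  exact Finset.prod_congr rfl fun i _ => lintegral_exp_neg_half_gaussianLogRatio (hv i)

lemma lintegral_pi_exp_half (hv : ∀ i, v i ≠ 0) :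
    ∫⁻ y, ENNReal.ofReal (Real.exp ((∑ i, gaussianLogRatio (m i) (v i) (y i)) / 2))
      ∂(Measure.pi fun i => gaussianReal (m i) (v i)) =
      ENNReal.ofReal (∏ i, gaussianAffinity (m i) (v i)) := by
  rw [← lintegral_pi_exp_neg_half hv, pi_gaussianReal_eq_withDensity hv,
    lintegral_withDensity_eq_lintegral_mul _ (by fun_prop) (by fun_prop)]
  refine lintegral_congr fun y => ?_
  rw [Pi.mul_apply, ← ENNReal.ofReal_mul (Real.exp_nonneg _), ← Real.exp_add]
  congr 2
  ring

/-- With `exp (-g)` the density of the second product against the first, integrate `F - g ≤ exp (F -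
g) - 1`. The integral of `g` is the sum of the entropies. -/
lemma dual_bound_pi_gaussianReal (hv : ∀ i, v i ≠ 0) {F : (ι → ℝ) → ℝ} (hF : Measurable F) {B : ℝ}
    (hB : ∀ y, |F y| ≤ B) :
    ∫ y, F y ∂(Measure.pi fun _ : ι => gaussianReal 0 1) -
      ∫ y, Real.exp (F y) ∂(Measure.pi fun i => gaussianReal (m i) (v i)) + 1 ≤
      ∑ i, gaussianEntropy (m i) (v i) := by
  set q : Measure (ι → ℝ) := Measure.pi fun _ : ι => gaussianReal 0 1
  set g : (ι → ℝ) → ℝ := fun y => ∑ i, gaussianLogRatio (m i) (v i) (y i) with hg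
  have hgi : ∀ i, Integrable (fun y : ι → ℝ => gaussianLogRatio (m i) (v i) (y i)) q := fun i =>
    (measurePreserving_eval (fun _ : ι => gaussianReal 0 1) i).integrable_comp_of_integrable
      integrable_gaussianLogRatio
  have hgint : Integrable g q := integrable_finsetSum _ fun i _ => hgi i
  have hgval : ∫ y, g y ∂q = ∑ i, gaussianEntropy (m i) (v i) := by
    rw [integral_finsetSum _ fun i _ => hgi i]
    refine Finset.sum_congr rfl fun i _ => ?_
    rw [← integral_gaussianLogRatio]
    exact integral_comp_eval (μ := fun _ : ι => gaussianReal 0 1)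
      continuous_gaussianLogRatio.aestronglyMeasurable
  have hFq : Integrable F q := integrable_of_abs_le hF hB
  have hexp : Integrable (fun y => Real.exp (F y))
      (Measure.pi fun i => gaussianReal (m i) (v i)) :=
    integrable_exp_of_le hF fun y => (le_abs_self _).trans (hB y)
  have hden : Measurable fun y => ENNReal.ofReal (Real.exp (-g y)) := by fun_prop
  rw [pi_gaussianReal_eq_withDensity hv] at hexp ⊢
  rw [integrable_withDensity_iff_integrable_smul' hden (ae_of_all _ fun _ => by simp)] at hexp
  rw [integral_withDensity_eq_integral_toReal_smul hden (ae_of_all _ fun _ => by simp), ← hgval]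
  have h1 : ∀ y, (ENNReal.ofReal (Real.exp (-g y))).toReal • Real.exp (F y) =
      Real.exp (F y - g y) := fun y => by
    rw [ENNReal.toReal_ofReal (Real.exp_nonneg _), smul_eq_mul, ← Real.exp_add]
    congr 1; ring
  simp only [h1] at hexp ⊢
  have h2 := integral_mono (hFq.sub hgint) (hexp.sub (integrable_const (1 : ℝ))) fun y => by
    have := Real.add_one_le_exp (F y - g y)
    simp only [Pi.sub_apply]
    linarith
  simp only [Pi.sub_apply] at h2
  rw [integral_sub hFq hgint, integral_sub hexp (integrable_const _)] at h2
  simp only [integral_const, probReal_univ, one_smul] at h2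
  linarith

lemma one_add_sum_le_prod_one_add {ι : Type*} (s : Finset ι) (f : ι → ℝ) (hf : ∀ i, 0 ≤ f i) :
    1 + ∑ i ∈ s, f i ≤ ∏ i ∈ s, (1 + f i) := by
  induction s using Finset.cons_induction with
  | empty => simp
  | cons a s ha ih =>
    rw [Finset.sum_cons, Finset.prod_cons]
    have h0 : 0 ≤ ∑ i ∈ s, f i := Finset.sum_nonneg fun i _ => hf i
    nlinarith [mul_le_mul_of_nonneg_left ih (by linarith [hf a] : 0 ≤ 1 + f a), hf a,
      mul_nonneg (hf a) h0]

/-- Chain `1 + ∑ E / 2 ≤ ∏ (1 + E / 2) ≤ ∏ A⁻⁴ ≤ c⁻²`, where `E` and `A` are the entropies and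
affinities. The bound is independent of the number of coordinates. -/
lemma sum_gaussianEntropy_le (hv : ∀ i, v i ≠ 0) {c : ℝ} (hc : 0 < c)
    (h : c ≤ (∏ i, gaussianAffinity (m i) (v i)) ^ 2) :
    ∑ i, gaussianEntropy (m i) (v i) ≤ 2 * (c ^ 2)⁻¹ := by
  have h1 := one_add_sum_le_prod_one_add Finset.univ
    (fun i => gaussianEntropy (m i) (v i) / 2) fun i => by
      have := gaussianEntropy_nonneg (m := m i) (hv i); positivity
  have h2 : ∏ i, (1 + gaussianEntropy (m i) (v i) / 2) ≤
      ∏ i, (gaussianAffinity (m i) (v i) ^ 4)⁻¹ :=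
    Finset.prod_le_prod (fun i _ => by
      have := gaussianEntropy_nonneg (m := m i) (hv i); positivity)
      fun i _ => one_add_gaussianEntropy_le (hv i)
  rw [Finset.prod_inv_distrib, Finset.prod_pow] at h2
  have h3 : ((∏ i, gaussianAffinity (m i) (v i)) ^ 4)⁻¹ ≤ (c ^ 2)⁻¹ := by
    refine inv_anti₀ (by positivity) ?_
    calc c ^ 2 ≤ ((∏ i, gaussianAffinity (m i) (v i)) ^ 2) ^ 2 := by gcongr
      _ = _ := by ring
  rw [← Finset.sum_div] at h1
  linarith

end ProductGaussian

/-! ### Equivalence of Gaussian measures -/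

section FeldmanHajek

open Filter Topology BoundedContinuousFunction

variable {H : Type*} [NormedAddCommGroup H] [InnerProductSpace ℝ H] [CompleteSpace H]
  [SecondCountableTopology H] [MeasurableSpace H] [BorelSpace H]

/-- Uncorrelated coordinates of a Gaussian measure are independent, so that their joint law is a
product of real Gaussian measures. -/
lemma map_inner_sub_eq_pi {ι : Type*} [Fintype ι] (P : Measure H) [IsGaussian P] (u : ι → H)
    (a : ι → ℝ) (hu : ∀ i j, i ≠ j → covarianceBilin P (u i) (u j) = 0) :
    P.map (fun z i => ⟪u i, z⟫ - a i) = Measure.pi fun i =>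
      gaussianReal (⟪u i, ∫ z, z ∂P⟫ - a i) (covarianceBilin P (u i) (u i)).toNNReal := by
  have hlaw : HasGaussianLaw (fun z : H => fun i => ⟪u i, z⟫) P :=
    (IsGaussian.hasGaussianLaw_id (μ := P)).map_fun
      (ContinuousLinearMap.pi fun i => innerSL ℝ (u i))
  have hind : iIndepFun (fun i (z : H) => ⟪u i, z⟫) P :=
    hlaw.iIndepFun_of_covariance_eq_zero fun i j hij => by
      rw [← covarianceBilin_apply_eq_cov IsGaussian.memLp_two_id]
      exact hu i j hij
  have hind' : iIndepFun (fun i (z : H) => ⟪u i, z⟫ - a i) P :=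
    hind.comp (fun i x => x - a i) fun i => by fun_prop
  rw [hind'.map_fun_eq_pi_map fun i => by fun_prop]
  congr
  ext1 i
  rw [← gaussianReal_map_sub_const, ← map_inner_eq_gaussianReal,
    Measure.map_map (by fun_prop) (by fun_prop)]
  rfl

/-- Otherwise the image of `P` along `x` would be a point mass, while that of `Q` has no atoms. -/
lemma covarianceBilin_self_pos_of_absolutelyContinuous {P Q : Measure H} [IsGaussian P]
    [IsGaussian Q] (hPQ : P ≪ Q) {x : H} (hx : 0 < covarianceBilin Q x x) :
    0 < covarianceBilin P x x := by
  refine (covarianceBilin_self_nonneg x).lt_of_ne' fun h0 => ?_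
  have hac : P.map (fun z => ⟪x, z⟫) ≪ Q.map (fun z => ⟪x, z⟫) := hPQ.map (by fun_prop)
  rw [map_inner_eq_gaussianReal, map_inner_eq_gaussianReal, h0, Real.toNNReal_zero,
    gaussianReal_zero_var] at hac
  have := nullSingletonClass_gaussianReal (μ := ⟪x, ∫ z, z ∂Q⟫)
    (v := (covarianceBilin Q x x).toNNReal) (by simpa using hx)
  have h1 := hac (measure_singleton ⟪x, ∫ z, z ∂P⟫)
  simp at h1

/-- The dual bound on functions depending on a finite-dimensional projection only. -/
lemma dual_bound_comp_starProjection {P Q : Measure H} [IsGaussian P] [IsGaussian Q] (hPQ : P ≪ Q)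
    (hQ : ∀ x, x ≠ 0 → 0 < covarianceBilin Q x x) {c : ℝ} (hc : 0 < c)
    (hcG : ∀ G : H → ℝ≥0∞, Measurable G → (∀ x, G x ≠ 0) → (∀ x, G x ≠ ∞) →
      ENNReal.ofReal c ≤ (∫⁻ x, G x ∂P) * ∫⁻ x, (G x)⁻¹ ∂Q)
    (V : Submodule ℝ H) [FiniteDimensional ℝ V] {f : H → ℝ} (hf : Measurable f) {B : ℝ}
    (hB : ∀ x, |f x| ≤ B) :
    ∫ z, f (V.starProjection z) ∂Q - ∫ z, Real.exp (f (V.starProjection z)) ∂P + 1 ≤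
      2 * (c ^ 2)⁻¹ := by
  obtain ⟨u, huV, huQ, huP⟩ := exists_family_simultaneously_diagonal V (covarianceBilin Q)
    (covarianceBilin P) covarianceBilin_comm covarianceBilin_comm hQ
  obtain ⟨S, hS, hSV⟩ := exists_continuous_starProjection_eq u V huV
  set a := fun i => ⟪u i, ∫ z, z ∂Q⟫
  set m := fun i => ⟪u i, ∫ z, z ∂P⟫ - a i
  set v := fun i => (covarianceBilin P (u i) (u i)).toNNReal
  set X : H → (Fin (Module.finrank ℝ V) → ℝ) := fun z i => ⟪u i, z⟫ - a i
  have hX : Measurable X := by fun_prop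
  have hXP : P.map X = Measure.pi fun i => gaussianReal (m i) (v i) :=
    map_inner_sub_eq_pi P u a huP
  have hXQ : Q.map X = Measure.pi fun _ => gaussianReal 0 1 := by
    rw [map_inner_sub_eq_pi Q u a fun i j hij => by rw [huQ, if_neg hij]]
    simp [huQ, a]
  have hv : ∀ i, v i ≠ 0 := fun i => by
    have h1 : 0 < covarianceBilin P (u i) (u i) :=
      covarianceBilin_self_pos_of_absolutelyContinuous hPQ (by simp [huQ])
    simpa [v] using h1
  set g : (Fin (Module.finrank ℝ V) → ℝ) → ℝ := fun y => ∑ i, gaussianLogRatio (m i) (v i) (y i)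
  have hg : Measurable g := by fun_prop
  -- Here `exp (g ∘ X)` is the density of `Q` against `P` on the chosen coordinates. Its square root
  -- makes both integrals equal to the affinity of the projections, the optimal case of
  -- Cauchy-Schwarz.
  have h1 := hcG (fun z => ENNReal.ofReal (Real.exp (g (X z) / 2))) (by fun_prop)
    (fun z => by simp [Real.exp_pos]) (fun z => by simp)
  have h2 : ∫⁻ z, ENNReal.ofReal (Real.exp (g (X z) / 2)) ∂P =
      ENNReal.ofReal (∏ i, gaussianAffinity (m i) (v i)) := by
    rw [← lintegral_pi_exp_half hv, ← hXP, lintegral_map (by fun_prop) hX]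
  have h3 : ∫⁻ z, (ENNReal.ofReal (Real.exp (g (X z) / 2)))⁻¹ ∂Q =
      ENNReal.ofReal (∏ i, gaussianAffinity (m i) (v i)) := by
    simp_rw [← ENNReal.ofReal_inv_of_pos (Real.exp_pos _), ← Real.exp_neg]
    rw [← lintegral_pi_exp_neg_half hv, ← hXQ, lintegral_map (by fun_prop) hX]
  have hprod : 0 ≤ ∏ i, gaussianAffinity (m i) (v i) :=
    Finset.prod_nonneg fun i _ => (gaussianAffinity_pos (hv i)).le
  rw [h2, h3, ← ENNReal.ofReal_mul hprod, ← pow_two,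
    ENNReal.ofReal_le_ofReal_iff (by positivity)] at h1
  have h4 := sum_gaussianEntropy_le hv hc h1
  set F : (Fin (Module.finrank ℝ V) → ℝ) → ℝ := fun y => f (S fun i => y i + a i)
  have hF : Measurable F := by fun_prop
  have h5 := dual_bound_pi_gaussianReal (m := m) hv hF fun y => hB _
  have hFX : ∀ z, F (X z) = f (V.starProjection z) := fun z => by simp [F, X, hSV]
  rw [← hXP, ← hXQ, integral_map hX.aemeasurable (by fun_prop),
    integral_map hX.aemeasurable (by fun_prop)] at h5
  simp only [hFX] at h5
  linarith

/-- A Gaussian measure which is absolutely continuous with respect to a nondegenerate Gaussian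
measure is equivalent to it. -/
theorem absolutelyContinuous_symm_of_isGaussian {P Q : Measure H} [IsGaussian P] [IsGaussian Q]
    (hPQ : P ≪ Q) (hQ : ∀ x, x ≠ 0 → 0 < covarianceBilin Q x x) : Q ≪ P := by
  obtain ⟨c, hc, hcG⟩ := exists_pos_le_lintegral_mul_lintegral_inv hPQ
  let U : ℕ → Submodule ℝ H := fun n =>
    Submodule.span ℝ (TopologicalSpace.denseSeq H '' (Finset.range n : Set ℕ))
  have hUfin : ∀ n, FiniteDimensional ℝ (U n) := fun n =>
    FiniteDimensional.span_of_finite ℝ ((Finset.finite_toSet _).image _)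
  have hUmono : Monotone U := fun n k hnk => Submodule.span_mono
    (Set.image_mono (by simpa using hnk))
  have hUtop : ⊤ ≤ (⨆ n, U n).topologicalClosure := by
    intro x _
    rw [← SetLike.mem_coe, Submodule.topologicalClosure_coe]
    refine closure_mono ?_ (TopologicalSpace.denseRange_denseSeq H x)
    rintro _ ⟨n, rfl⟩
    exact Submodule.mem_iSup_of_mem (n + 1) (Submodule.subset_span ⟨n, by simp, rfl⟩)
  -- The roles are exchanged: the dual expressions of `Q` against `P` are bounded. For continuous
  -- `f` they are limits of those of `f` composed with projections, and the bound is uniform in `n`.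
  refine absolutelyContinuous_of_dual_bound (K := 2 * (c ^ 2)⁻¹) fun f B hf hB =>
    dual_bound_of_boundedContinuous (fun f => ?_) hf hB
  have hB : ∀ x, |f x| ≤ ‖f‖ := fun x => f.norm_coe_le_norm x
  have hlim : ∀ z, Tendsto (fun n => f ((U n).starProjection z)) atTop (𝓝 (f z)) := fun z =>
    (f.continuous.tendsto z).comp (Submodule.starProjection_tendsto_self U hUmono z hUtop)
  have hmeas : ∀ n, Continuous fun z => f ((U n).starProjection z) := fun n =>
    f.continuous.comp (U n).starProjection.continuous
  have h1 : Tendsto (fun n => ∫ z, f ((U n).starProjection z) ∂Q) atTop (𝓝 (∫ z, f z ∂Q)) :=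
    tendsto_integral_of_dominated_convergence (fun _ => ‖f‖)
      (fun n => (hmeas n).aestronglyMeasurable) (integrable_const _)
      (fun n => ae_of_all _ fun z => hB _) (ae_of_all _ hlim)
  have h2 : Tendsto (fun n => ∫ z, Real.exp (f ((U n).starProjection z)) ∂P) atTop
      (𝓝 (∫ z, Real.exp (f z) ∂P)) :=
    tendsto_integral_of_dominated_convergence (fun _ => Real.exp ‖f‖)
      (fun n => (hmeas n).rexp.aestronglyMeasurable) (integrable_const _)
      (fun n => ae_of_all _ fun z => by
        rw [Real.norm_eq_abs, Real.abs_exp]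
        exact Real.exp_le_exp.2 ((le_abs_self _).trans (hB _)))
      (ae_of_all _ fun z => (Real.continuous_exp.tendsto _).comp (hlim z))
  exact le_of_tendsto' ((h1.sub h2).add_const 1) fun n =>
    dual_bound_comp_starProjection hPQ hQ hc hcG (U n) f.continuous.measurable hB

end FeldmanHajek

/-! ### The direct method and closedness of the classes -/

section Minimisation

open Filter Topology

/-- The direct method: the Kullback-Leibler divergence attains its minimum over a class of
probability measures which is closed under limits of tight families. -/
lemma exists_isMinOn_klDiv {H : Type*} [MetricSpace H] [CompleteSpace H]
    [SecondCountableTopology H] [MeasurableSpace H] [BorelSpace H] (μ : Measure H)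
    [IsProbabilityMeasure μ] {A : Set (Measure H)}
    (hprob : ∀ ν ∈ A, IsProbabilityMeasure ν)
    (hclosed : ∀ (U : Ultrafilter ℕ) (ν : ℕ → ProbabilityMeasure H) (ρ : ProbabilityMeasure H),
      (∀ i, (ν i : Measure H) ∈ A) → Tendsto ν U (𝓝 ρ) →
      IsTightMeasureSet (Set.range fun i => (ν i : Measure H)) →
      klDiv (ρ : Measure H) μ < ∞ → (ρ : Measure H) ∈ A)
    (hfin : ∃ ν ∈ A, klDiv ν μ < ∞) :
    ∃ νm ∈ A, IsMinOn (fun ν => klDiv ν μ) A νm := by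
  obtain ⟨ν₀, hν₀, hν₀fin⟩ := hfin
  set S : Set ℝ≥0∞ := (fun ν => klDiv ν μ) '' A
  have hS : sInf S < ∞ := (sInf_le (Set.mem_image_of_mem _ hν₀)).trans_lt hν₀fin
  obtain ⟨d, -, hd, hdS⟩ := exists_seq_tendsto_sInf (S := S) ⟨_, Set.mem_image_of_mem _ hν₀⟩
    (OrderBot.bddBelow S)
  -- Dropping the first `k` terms puts the whole sequence in one sublevel set, which is tight.
  obtain ⟨k, hk⟩ := (hd.eventually_lt_const
    (ENNReal.lt_add_right hS.ne one_ne_zero)).exists_forall_of_atTop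
  have hd' : Tendsto (fun n => d (n + k)) atTop (𝓝 (sInf S)) := hd.comp (tendsto_add_atTop_nat k)
  choose ν hνA hνd using fun n => hdS (n + k)
  let p : ℕ → ProbabilityMeasure H := fun n => ⟨ν n, hprob _ (hνA n)⟩
  have htight : IsTightMeasureSet (Set.range fun n => (p n : Measure H)) := by
    refine (isTightMeasureSet_klDiv_le μ (K := sInf S + 1) (by simp [hS.ne])).subset ?_
    rintro _ ⟨n, rfl⟩
    refine ⟨hprob _ (hνA n), ?_⟩
    rw [show klDiv (p n : Measure H) μ = d (n + k) from hνd n]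
    exact (hk _ (Nat.le_add_left _ _)).le
  have hcpt : IsCompact (closure (Set.range p)) :=
    isCompact_closure_of_isTightMeasureSet (by
      convert htight using 1
      ext; simp)
  -- A free ultrafilter replaces the extraction of subsequences: it refines `atTop`, so the
  -- divergences still tend to the infimum.
  let U : Ultrafilter ℕ := Filter.hyperfilter ℕ
  have hU : (U : Filter ℕ) ≤ atTop := Nat.hyperfilter_le_atTop
  obtain ⟨ρ, -, hρ⟩ := hcpt.ultrafilter_le_nhds (U.map p) (by
    rw [le_principal_iff]
    exact Filter.mem_of_superset (Filter.image_mem_map Filter.univ_mem)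
      (Set.image_univ ▸ subset_closure))
  have hρ : Tendsto p U (𝓝 ρ) := hρ
  have hkl : Tendsto (fun n => klDiv (p n : Measure H) μ) U (𝓝 (sInf S)) := by
    simpa only [p, ProbabilityMeasure.coe_mk, hνd] using hd'.mono_left hU
  have hle := klDiv_le_of_tendsto hρ hkl
  exact ⟨ρ, hclosed U p ρ hνA hρ htight (hle.trans_lt hS),
    fun ν hν => hle.trans (sInf_le (Set.mem_image_of_mem _ hν))⟩

variable {H : Type*} [NormedAddCommGroup H] [InnerProductSpace ℝ H] [MeasurableSpace H]
  [BorelSpace H]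

/-- By polarisation, diagonal values suffice. -/
lemma covarianceBilin_ext {ν ρ : Measure H}
    (h : ∀ x, covarianceBilin ρ x x = covarianceBilin ν x x) (x y : H) :
    covarianceBilin ρ x y = covarianceBilin ν x y := by
  have h1 := h (x + y)
  simp only [map_add, add_apply, h x, h y] at h1
  rw [covarianceBilin_comm (μ := ρ) y x, covarianceBilin_comm (μ := ν) y x] at h1
  linarith

variable [CompleteSpace H] [SecondCountableTopology H]

section Closed

variable {U : Ultrafilter ℕ} {ν : ℕ → ProbabilityMeasure H} {ρ : ProbabilityMeasure H}

lemma mem_gaussiansWithCovariance_of_tendsto {C : H →L[ℝ] H}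
    (hν : ∀ i, (ν i : Measure H) ∈ gaussiansWithCovariance C) (hlim : Tendsto ν U (𝓝 ρ))
    (htight : IsTightMeasureSet (Set.range fun i => (ν i : Measure H))) :
    (ρ : Measure H) ∈ gaussiansWithCovariance C := by
  have hG : ∀ i, IsGaussian (ν i : Measure H) := fun i => (hν i).1
  refine ⟨isGaussian_of_tendsto hG hlim htight, fun x y => ?_⟩
  rw [← (hν 0).2 x y]
  refine covarianceBilin_ext (fun z => ?_) x y
  refine tendsto_nhds_unique (tendsto_mean_and_covarianceBilin hG hlim htight z).2 ?_
  simp_rw [(hν _).2 z z]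
  exact tendsto_const_nhds

lemma mem_gaussiansWithMean_of_tendsto {m : H}
    (hν : ∀ i, (ν i : Measure H) ∈ gaussiansWithMean m) (hlim : Tendsto ν U (𝓝 ρ))
    (htight : IsTightMeasureSet (Set.range fun i => (ν i : Measure H))) :
    (ρ : Measure H) ∈ gaussiansWithMean m := by
  have hG : ∀ i, IsGaussian (ν i : Measure H) := fun i => (hν i).1
  refine ⟨isGaussian_of_tendsto hG hlim htight, ext_inner_left ℝ fun x => ?_⟩
  refine tendsto_nhds_unique (tendsto_mean_and_covarianceBilin hG hlim htight x).1 ?_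
  simp_rw [(hν _).2]
  exact tendsto_const_nhds

end Closed

end Minimisation

/-! ### The target measure -/

section Target

variable {X H : Type*} {ι : X → H} {Φ : X → ℝ}

lemma unnormalisedDensity_nonneg (hι : Function.Injective ι) (x : H) :
    0 ≤ unnormalisedDensity ι Φ x := by
  unfold unnormalisedDensity
  by_cases hx : ∃ a, ι a = x
  · obtain ⟨a, rfl⟩ := hx
    rw [hι.extend_apply]
    exact Real.exp_nonneg _
  · rw [Function.extend_apply' _ _ _ hx]

lemma unnormalisedDensity_pos (hι : Function.Injective ι) {x : H} (hx : x ∈ Set.range ι) :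
    0 < unnormalisedDensity ι Φ x := by
  obtain ⟨a, rfl⟩ := hx
  rw [unnormalisedDensity, hι.extend_apply]
  exact Real.exp_pos _

variable [MeasurableSpace H] {μ₀ : Measure H}

lemma normalisation_pos [NeZero μ₀] (hι : Function.Injective ι)
    (hrange : ∀ᵐ x ∂μ₀, x ∈ Set.range ι) (hint : Integrable (unnormalisedDensity ι Φ) μ₀) :
    0 < normalisation μ₀ ι Φ := by
  rw [normalisation, integral_pos_iff_support_of_nonneg (unnormalisedDensity_nonneg hι) hint,
    pos_iff_ne_zero]
  intro h0
  refine NeZero.ne μ₀ (Measure.measure_univ_eq_zero.1 (measure_mono_null ?_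
    (measure_union_null h0 (ae_iff.1 hrange))))
  intro x _
  by_cases hx : x ∈ Set.range ι
  · exact Or.inl (unnormalisedDensity_pos hι hx).ne'
  · exact Or.inr hx

lemma isProbabilityMeasure_target [NeZero μ₀] (hι : Function.Injective ι)
    (hrange : ∀ᵐ x ∂μ₀, x ∈ Set.range ι) (hint : Integrable (unnormalisedDensity ι Φ) μ₀) :
    IsProbabilityMeasure (target μ₀ ι Φ) := by
  have hZ := normalisation_pos hι hrange hint
  refine ⟨?_⟩
  rw [target, withDensity_apply _ MeasurableSet.univ, setLIntegral_univ,
    ← ofReal_integral_eq_lintegral_ofReal (hint.div_const _)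
      (ae_of_all _ fun x => div_nonneg (unnormalisedDensity_nonneg hι x) hZ.le),
    integral_div, ← normalisation, div_self hZ.ne', ENNReal.ofReal_one]

end Target

end GaussianKL

theorem mainTheorem1
    {H : Type*} [NormedAddCommGroup H] [InnerProductSpace ℝ H] [CompleteSpace H]
    [TopologicalSpace.SeparableSpace H] [MeasurableSpace H] [BorelSpace H]
    -- `X` is a separable Banach space continuously embedded in `H` through `ι`
    {X : Type*} [NormedAddCommGroup X] [NormedSpace ℝ X] [CompleteSpace X]
    [TopologicalSpace.SeparableSpace X] [MeasurableSpace X] [BorelSpace X]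
    (ι : X →L[ℝ] H) (hι : Function.Injective ι) (hX : MeasurableSet (Set.range ι))
    -- the Gaussian reference measure, with strictly positive covariance operator
    (μ₀ : Measure H) [IsGaussian μ₀] (C₀ : H →L[ℝ] H) (hC₀ : GaussianKL.HasCovariance μ₀ C₀)
    (hC₀_pos : ∀ x : H, x ≠ 0 → 0 < ⟪x, C₀ x⟫)
    (hμ₀X : μ₀ (Set.range ι) = 1)
    (Φ : X → ℝ) (hΦ : Measurable Φ)
    (hΦ_int : Integrable (GaussianKL.unnormalisedDensity ι Φ) μ₀)
    -- the class `A` over which one minimises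
    (A : Set (Measure H))
    (hA : A = GaussianKL.gaussians H ∨
      A = GaussianKL.gaussiansEquivalentTo μ₀ ∨
      (∃ C : H →L[ℝ] H, A = GaussianKL.gaussiansWithCovariance C) ∨
      (∃ m : H, A = GaussianKL.gaussiansWithMean m))
    (hfin : ∃ ν ∈ A, klDiv ν (GaussianKL.target μ₀ ι Φ) < ∞) :
    (∃ νm ∈ A, IsMinOn (fun ν => klDiv ν (GaussianKL.target μ₀ ι Φ)) A νm) ∧
    (∀ νm ∈ A, IsMinOn (fun ν => klDiv ν (GaussianKL.target μ₀ ι Φ)) A νm →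
      GaussianKL.MeasureEquivalent νm μ₀) ∧
    (∀ ν ∈ A, klDiv ν (GaussianKL.target μ₀ ι Φ) < ∞ → GaussianKL.MeasureEquivalent ν μ₀) := by
  have : SecondCountableTopology H := UniformSpace.secondCountable_of_separable H
  have hrange : ∀ᵐ x ∂μ₀, x ∈ Set.range ι := (prob_compl_eq_zero_iff hX).2 hμ₀X
  have hprob : IsProbabilityMeasure (GaussianKL.target μ₀ ι Φ) :=
    GaussianKL.isProbabilityMeasure_target hι hrange hΦ_int
  have hpos : ∀ x, x ≠ 0 → 0 < covarianceBilin μ₀ x x := fun x hx => hC₀ x x ▸ hC₀_pos x hx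
  have hequiv : ∀ ν : Measure H, IsGaussian ν → klDiv ν (GaussianKL.target μ₀ ι Φ) < ∞ →
      GaussianKL.MeasureEquivalent ν μ₀ := fun ν hν hkl => by
    have hac : ν ≪ μ₀ :=
      (klDiv_ne_top_iff.1 hkl.ne).1.trans (withDensity_absolutelyContinuous _ _)
    exact ⟨hac, GaussianKL.absolutelyContinuous_symm_of_isGaussian hac hpos⟩
  have hgauss : ∀ ν ∈ A, IsGaussian ν := by
    rcases hA with rfl | rfl | ⟨C, rfl⟩ | ⟨m, rfl⟩
    · exact fun ν hν => hν
    all_goals exact fun ν hν => hν.1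
  refine ⟨?_, fun νm hνm hmin => ?_, fun ν hν => hequiv ν (hgauss ν hν)⟩
  · refine GaussianKL.exists_isMinOn_klDiv _ (fun ν hν => (hgauss ν hν).toIsProbabilityMeasure)
      (fun U ν ρ hν hlim htight hkl => ?_) hfin
    have hG := GaussianKL.isGaussian_of_tendsto (fun i => hgauss _ (hν i)) hlim htight
    rcases hA with rfl | rfl | ⟨C, rfl⟩ | ⟨m, rfl⟩
    · exact hG
    -- Equivalence to `μ₀` need not pass to weak limits; it is recovered from the finite divergence
    -- of the limit.
    · exact ⟨hG, hequiv _ hG hkl⟩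
    · exact GaussianKL.mem_gaussiansWithCovariance_of_tendsto hν hlim htight
    · exact GaussianKL.mem_gaussiansWithMean_of_tendsto hν hlim htight
  · obtain ⟨ν, hν, hfinν⟩ := hfin
    exact hequiv νm (hgauss νm hνm) ((hmin hν).trans_lt hfinν)
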